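/- **Setting.** Let $H_1,G_1$ be real Hilbert spaces and $S_1\colon H_1\to G_1$ a compact linear operator. Let $\lambda_1\ge\lambda_2\ge\dots\ge 0$ be the eigenvalues of $W_1=S_1^\dagger S_1$, counted with multiplicity (and continued by zeros if there are only finitely many positive ones), and assume $\lambda_2>0$. For $d\in\mathbb N=\{1,2,\dots\}$ let $H_d=H_1\otimes\dots\otimes H_1$ and $G_d=G_1\otimes\dots\otimes G_1$ be the $d$-fold Hilbert space tensor products and $S_d=S_1\otimes\dots\otimes S_1\colon H_d\to G_d$. Let $\emptyset\ne I_d\subseteq\{1,\dots,d\}$ and $a_d=\#I_d$. Let $\mathcal S_{I_d}$ be the group of permutations of $\{1,\dots,d\}$ that fix every element outside $I_d$. The antisymmetrizer $\mathfrak A_{I_d}$ is the bounded linear operator on $H_d$ with $$\mathfrak A_{I_d}(f_1\otimes\dots\otimes f_d)=\frac1{\#\mathcal S_{I_d}}\sum_{\pi\in\mathcal S_{I_d}}(-1)^{|\pi|}\,f_{\pi(1)}\otimes\dots\otimes f_{\pi(d)}.$$ The $I_d$-antisymmetric problem is to approximate the restriction of $S_d$ to $F_d=\mathfrak A_{I_d}(H_d)$.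 An algorithm using $n$ pieces of information is a map $A=\phi\circ N\colon F_d\to G_d$, where $N(f)=(y_1,\dots,y_n)$, $y_v=L_v(f;y_1,\dots,y_{v-1})$, each $L_v(\,\cdot\,;y_1,\dots,y_{v-1})$ is a continuous linear functional on $F_d$, and $\phi\colon\mathbb R^n\to G_d$ is arbitrary. The $n$-th minimal error is $$e(n,d)=\inf_A\ \sup_{f\in F_d,\ \|f\|\le1}\|Af-S_df\|,$$ the infimum being over all such algorithms. The initial error is $\epsilon_d^{\rm init}=e(0,d)$, and the information complexity is $n(\epsilon,d)=\min\{n\in\mathbb N_0: e(n,d)\le\epsilon\}$. Assume $\epsilon_d^{\rm init}>0$ for all $d\in\mathbb N$. **Proposition (necessary conditions, antisymmetric case).** Suppose that the problem is polynomially tractable with respect to the absolute error criterion with constants $C,p>0$ and $q\ge0$, i.e. $$n(\epsilon,d)\le C\,\epsilon^{-p}\,d^{\,q}\qquad\text{for all } d\in\mathbb N,\ \epsilon\in(0,1].$$ Then the following hold. 1. As $d\to\infty$, the initial error tends to zero faster than the inverse of any polynomial: $\lim_{d\to\infty}d^k\,\epsilon_d^{\rm init}=0$ for every $k\in\mathbb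 N_0$. 2. For every $\tau>p/2$ we have $\lambda\in\ell_\tau$, i.e. $\|\lambda\|_\tau^\tau:=\sum_{m\ge1}\lambda_m^\tau<\infty$, and for every $\delta>0$ there is $d_0\in\mathbb N$ such that $$\ln\left(\|\lambda\|_\tau^\tau\right)-\delta\le\frac1d\sum_{k=1}^{a_d}\ln\left(\frac{\|\lambda\|_\tau^\tau}{\lambda_k^\tau}\right)\qquad\text{for all } d\ge d_0.$$ 3. $\lambda_1<1$ or $\lim_{d\to\infty}a_d=\infty$. -/

import Mathlib

open Filter Topology
open scoped ENNReal TensorProduct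

noncomputable section

/-! ### The Hilbert space tensor power `H ⊗ ⋯ ⊗ H` (`d` factors) -/

section Kernels

variable {H G : Type*} [NormedAddCommGroup H] [InnerProductSpace ℝ H]
  [NormedAddCommGroup G] [InnerProductSpace ℝ G]

/-- A symmetric bilinear form that is positive semidefinite gives positive semidefinite
kernels. -/
theorem posSemidef_kernel_of_form {ι E : Type*} [AddCommGroup E] [Module ℝ E]
    (B : E →ₗ[ℝ] E →ₗ[ℝ] ℝ) (hs : ∀ x y, B x y = B y x) (hB : ∀ x, 0 ≤ B x x) (v : ι → E) :
    (Matrix.of fun i j => B (v i) (v j)).PosSemidef := by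
  refine ⟨Matrix.ext fun i j => by simpa using hs _ _, fun c => ?_⟩
  have h := hB (c.sum fun i a => a • v i)
  simp only [Finsupp.sum, map_sum, LinearMap.sum_apply, map_smul, LinearMap.smul_apply,
    smul_eq_mul] at h
  refine h.trans_eq ?_
  simp only [Finsupp.sum, star_trivial, Matrix.of_apply, Finset.mul_sum]
  rw [Finset.sum_comm]
  exact Finset.sum_congr rfl fun i _ => Finset.sum_congr rfl fun j _ => by ring

/-- Entrywise products of positive semidefinite matrices are monotone with respect to the
positive semidefinite order. -/
theorem posSemidef_prod_sub_prod {ι κ : Type*} (s : Finset κ) (A B : κ → Matrix ι ι ℝ)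
    (hB : ∀ l, (B l).PosSemidef) (hAB : ∀ l, (A l - B l).PosSemidef) :
    (Matrix.of fun i j => ∏ l ∈ s, B l i j).PosSemidef ∧
      (Matrix.of fun i j => (∏ l ∈ s, A l i j) - ∏ l ∈ s, B l i j).PosSemidef := by
  classical
  induction s using Finset.induction_on with
  | empty =>
    refine ⟨?_, ?_⟩
    · simpa using posSemidef_kernel_of_form (LinearMap.mul ℝ ℝ) (fun x y => mul_comm x y)
        (fun x => mul_self_nonneg x) (fun _ : ι => (1 : ℝ))
    · simpa using posSemidef_kernel_of_form (0 : ℝ →ₗ[ℝ] ℝ →ₗ[ℝ] ℝ) (by simp)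
        (by simp) (fun _ : ι => (1 : ℝ))
  | insert l s hl ih =>
    have hA : (A l).PosSemidef := by simpa using (hAB l).add (hB l)
    refine ⟨?_, ?_⟩
    · have e : (Matrix.of fun i j => ∏ l ∈ insert l s, B l i j)
          = (B l).hadamard (Matrix.of fun i j => ∏ l ∈ s, B l i j) := by
        ext i j
        simp [Finset.prod_insert hl]
      rw [e]
      exact (hB l).hadamard ih.1
    · have e : (Matrix.of fun i j => (∏ l ∈ insert l s, A l i j) - ∏ l ∈ insert l s, B l i j)
          = (A l).hadamard (Matrix.of fun i j => (∏ l ∈ s, A l i j) - ∏ l ∈ s, B l i j)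
            + (A l - B l).hadamard (Matrix.of fun i j => ∏ l ∈ s, B l i j) := by
        ext i j
        simp [Finset.prod_insert hl]
        ring
      rw [e]
      exact (hA.hadamard ih.2).add ((hAB l).hadamard ih.1)

end Kernels

/-- The algebraic `d`-fold tensor power of `H` (a copy of `⨂[ℝ] _ : Fin d, H` that does not
carry the projective seminorm). -/
def AlgTensorPower (d : ℕ) (H : Type*) [NormedAddCommGroup H] [InnerProductSpace ℝ H] : Type _ :=
  ⨂[ℝ] _ : Fin d, H

namespace AlgTensorPower

variable {d : ℕ} {H G : Type*} [NormedAddCommGroup H] [InnerProductSpace ℝ H]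
  [NormedAddCommGroup G] [InnerProductSpace ℝ G]

instance : AddCommGroup (AlgTensorPower d H) :=
  inferInstanceAs (AddCommGroup (⨂[ℝ] _ : Fin d, H))

instance : Module ℝ (AlgTensorPower d H) :=
  inferInstanceAs (Module ℝ (⨂[ℝ] _ : Fin d, H))

/-- The simple tensor `f 0 ⊗ ⋯ ⊗ f (d - 1)`. -/
def tprod (d : ℕ) (H : Type*) [NormedAddCommGroup H] [InnerProductSpace ℝ H] :
    MultilinearMap ℝ (fun _ : Fin d => H) (AlgTensorPower d H) :=
  PiTensorProduct.tprod ℝ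

/-- The bilinear form with `(⊗ f, ⊗ g) ↦ ∏ l, ⟪f l, g l⟫`. -/
def form (d : ℕ) (H : Type*) [NormedAddCommGroup H] [InnerProductSpace ℝ H] :
    AlgTensorPower d H →ₗ[ℝ] AlgTensorPower d H →ₗ[ℝ] ℝ :=
  PiTensorProduct.dualDistrib ∘ₗ PiTensorProduct.map (fun _ : Fin d => innerₗ H)

/-- The linear map `S ⊗ ⋯ ⊗ S`. -/
def map (d : ℕ) (S : H →ₗ[ℝ] G) : AlgTensorPower d H →ₗ[ℝ] AlgTensorPower d G :=
  PiTensorProduct.map fun _ : Fin d => S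

/-- The linear map with `⊗ f ↦ ⊗ (f ∘ π)`. -/
def perm (π : Equiv.Perm (Fin d)) : AlgTensorPower d H →ₗ[ℝ] AlgTensorPower d H :=
  (PiTensorProduct.reindex ℝ (fun _ : Fin d => H) π.symm).toLinearMap

theorem form_tprod (f g : Fin d → H) :
    form d H (tprod d H f) (tprod d H g) = ∏ l, inner ℝ (f l) (g l) := by
  have h := PiTensorProduct.dualDistrib_apply (R := ℝ) (fun l => innerₗ H (f l)) g
  rw [← PiTensorProduct.map_tprod] at h
  exact h

theorem map_tprod (S : H →ₗ[ℝ] G) (f : Fin d → H) :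
    map d S (tprod d H f) = tprod d G fun l => S (f l) := by
  exact PiTensorProduct.map_tprod _ _

theorem perm_tprod (π : Equiv.Perm (Fin d)) (f : Fin d → H) :
    perm π (tprod d H f) = tprod d H (f ∘ π) := by
  exact PiTensorProduct.reindex_tprod _ _

theorem exists_finsupp (x : AlgTensorPower d H) :
    ∃ c : (Fin d → H) →₀ ℝ, (c.sum fun f a => a • tprod d H f) = x := by
  have hx : x ∈ Submodule.span ℝ (Set.range (tprod d H)) := by
    have h : Submodule.span ℝ (Set.range (tprod d H)) = ⊤ := PiTensorProduct.span_tprod_eq_top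
    rw [h]
    trivial
  exact Finsupp.mem_span_range_iff_exists_finsupp.1 hx

theorem form_sum_sum (c c' : (Fin d → H) →₀ ℝ) :
    form d H (c.sum fun f a => a • tprod d H f) (c'.sum fun f a => a • tprod d H f)
      = c.sum fun f a => c'.sum fun g b => a * (∏ l, inner ℝ (f l) (g l)) * b := by
  simp only [Finsupp.sum, map_sum, LinearMap.sum_apply, map_smul, LinearMap.smul_apply,
    smul_eq_mul, form_tprod, Finset.mul_sum]
  rw [Finset.sum_comm]
  exact Finset.sum_congr rfl fun i _ => Finset.sum_congr rfl fun j _ => by ring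

theorem form_symm (x y : AlgTensorPower d H) : form d H x y = form d H y x := by
  obtain ⟨c, rfl⟩ := exists_finsupp x
  obtain ⟨c', rfl⟩ := exists_finsupp y
  rw [form_sum_sum, form_sum_sum, Finsupp.sum_comm]
  simp only [Finsupp.sum]
  refine Finset.sum_congr rfl fun i _ => Finset.sum_congr rfl fun j _ => ?_
  simp_rw [real_inner_comm]
  ring

theorem form_map_le (S : H →L[ℝ] G) (x : AlgTensorPower d H) :
    0 ≤ form d G (map d S.toLinearMap x) (map d S.toLinearMap x) ∧
      form d G (map d S.toLinearMap x) (map d S.toLinearMap x)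
        ≤ (‖S‖ ^ 2) ^ d * form d H x x := by
  obtain ⟨c, rfl⟩ := exists_finsupp x
  have hB : ∀ l : Fin d, (Matrix.of fun f g : Fin d → H =>
      (inner ℝ (S (f l)) (S (g l)) : ℝ)).PosSemidef := fun l =>
    posSemidef_kernel_of_form (innerₗ G) (fun x y => real_inner_comm y x)
      (fun x => real_inner_self_nonneg) (fun f : Fin d → H => S (f l))
  have hAB : ∀ l : Fin d, ((Matrix.of fun f g : Fin d → H =>
      ‖S‖ ^ 2 * (inner ℝ (f l) (g l) : ℝ)) - (Matrix.of fun f g : Fin d → H =>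
      (inner ℝ (S (f l)) (S (g l)) : ℝ))).PosSemidef := fun l => by
    have h := posSemidef_kernel_of_form
      (‖S‖ ^ 2 • innerₗ H - (innerₗ G).compl₁₂ S.toLinearMap S.toLinearMap)
      (fun x y => by simp [real_inner_comm])
      (fun x => by
        have h1 := S.le_opNorm x
        have h2 : ‖S x‖ ^ 2 ≤ (‖S‖ * ‖x‖) ^ 2 := by gcongr
        simp only [LinearMap.sub_apply, LinearMap.smul_apply, LinearMap.compl₁₂_apply,
          innerₗ_apply_apply, ContinuousLinearMap.coe_coe, real_inner_self_eq_norm_sq, smul_eq_mul]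
        nlinarith) (fun f : Fin d → H => f l)
    convert h using 1
    ext f g
    simp
  obtain ⟨h1, h2⟩ := posSemidef_prod_sub_prod Finset.univ _ _ hB hAB
  have h1 := h1.2 c
  have h2 := h2.2 c
  have e : map d S.toLinearMap (c.sum fun f a => a • tprod d H f)
      = c.sum fun f a => a • tprod d G fun l => S (f l) := by
    simp [Finsupp.sum, map_tprod]
  have e2 : form d G (map d S.toLinearMap (c.sum fun f a => a • tprod d H f))
      (map d S.toLinearMap (c.sum fun f a => a • tprod d H f))
      = c.sum fun f a => c.sum fun g b => a * (∏ l, inner ℝ (S (f l)) (S (g l))) * b := by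
    rw [e]
    simp only [Finsupp.sum, map_sum, LinearMap.sum_apply, map_smul, LinearMap.smul_apply,
      smul_eq_mul, form_tprod, Finset.mul_sum]
    rw [Finset.sum_comm]
    exact Finset.sum_congr rfl fun i _ => Finset.sum_congr rfl fun j _ => by ring
  rw [e2, form_sum_sum]
  refine ⟨by simpa using h1, ?_⟩
  rw [← sub_nonneg]
  refine h2.trans_eq ?_
  simp only [Finsupp.sum, star_trivial, Matrix.of_apply, Finset.prod_mul_distrib,
    Finset.prod_const, Finset.card_univ, Fintype.card_fin, Finset.mul_sum,
    ← Finset.sum_sub_distrib]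
  exact Finset.sum_congr rfl fun i _ => Finset.sum_congr rfl fun j _ => by ring

theorem form_self_nonneg (x : AlgTensorPower d H) : 0 ≤ form d H x x := by
  have h := (form_map_le (ContinuousLinearMap.id ℝ H) x).1
  have e : map d (ContinuousLinearMap.id ℝ H).toLinearMap x = x := by
    obtain ⟨c, rfl⟩ := exists_finsupp x
    simp [Finsupp.sum, map_tprod]
  rwa [e] at h

theorem form_perm (π : Equiv.Perm (Fin d)) (x y : AlgTensorPower d H) :
    form d H (perm π x) (perm π y) = form d H x y := by
  obtain ⟨c, rfl⟩ := exists_finsupp x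
  obtain ⟨c', rfl⟩ := exists_finsupp y
  simp only [Finsupp.sum, map_sum, LinearMap.sum_apply, map_smul, LinearMap.smul_apply,
    perm_tprod, form_tprod, Function.comp_apply]
  refine Finset.sum_congr rfl fun i _ => ?_
  refine congrArg _ (Finset.sum_congr rfl fun j _ => ?_)
  rw [Equiv.prod_comp π fun l => inner ℝ (j l) (i l)]

instance : PreInnerProductSpace.Core ℝ (AlgTensorPower d H) where
  inner x y := form d H x y
  conj_inner_symm x y := form_symm y x
  re_inner_nonneg x := form_self_nonneg x
  add_left x y z := by simp
  smul_left x y r := by simp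

instance : SeminormedAddCommGroup (AlgTensorPower d H) :=
  InnerProductSpace.Core.toSeminormedAddCommGroup (𝕜 := ℝ)

instance : InnerProductSpace ℝ (AlgTensorPower d H) := .ofCore _

theorem inner_eq_form (x y : AlgTensorPower d H) : inner ℝ x y = form d H x y := rfl

/-- `S ⊗ ⋯ ⊗ S` as a bounded operator on the algebraic tensor power. -/
def mapL (d : ℕ) (S : H →L[ℝ] G) : AlgTensorPower d H →L[ℝ] AlgTensorPower d G :=
  (map d S.toLinearMap).mkContinuous (‖S‖ ^ d) fun x => by
    have h := (form_map_le S x).2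
    rw [← inner_eq_form, ← inner_eq_form, real_inner_self_eq_norm_sq,
      real_inner_self_eq_norm_sq] at h
    refine le_of_sq_le_sq (h.trans_eq (by ring)) (by positivity)

/-- `perm π` as a bounded operator. -/
def permL (π : Equiv.Perm (Fin d)) : AlgTensorPower d H →L[ℝ] AlgTensorPower d H :=
  (perm π).mkContinuous 1 fun x => by
    have h := form_perm π x x
    rw [← inner_eq_form, ← inner_eq_form, real_inner_self_eq_norm_sq,
      real_inner_self_eq_norm_sq] at h
    rw [one_mul]
    exact le_of_sq_le_sq h.le (norm_nonneg _)

end AlgTensorPower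

/-- The `d`-fold tensor product Hilbert space `H_d = H ⊗ ⋯ ⊗ H`: the completion of the algebraic
tensor power with respect to the inner product `⟪⊗ f, ⊗ g⟫ = ∏ l, ⟪f l, g l⟫`. -/
abbrev TensorPowerHilbert (d : ℕ) (H : Type*) [NormedAddCommGroup H] [InnerProductSpace ℝ H] :
    Type _ :=
  UniformSpace.Completion (AlgTensorPower d H)

section Problem

variable {H G : Type*} [NormedAddCommGroup H] [InnerProductSpace ℝ H]
  [NormedAddCommGroup G] [InnerProductSpace ℝ G]

/-- The simple tensor `f 0 ⊗ ⋯ ⊗ f (d - 1)` in `H_d`. -/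
def simpleTensor {d : ℕ} (f : Fin d → H) : TensorPowerHilbert d H :=
  (AlgTensorPower.tprod d H f : AlgTensorPower d H)

theorem inner_simpleTensor {d : ℕ} (f g : Fin d → H) :
    inner ℝ (simpleTensor f) (simpleTensor g) = ∏ l, inner ℝ (f l) (g l) := by
  simp [simpleTensor, AlgTensorPower.inner_eq_form, AlgTensorPower.form_tprod]

/-- The tensor product operator `S_d = S ⊗ ⋯ ⊗ S : H_d → G_d`. -/
def tensorPowerOp (d : ℕ) (S : H →L[ℝ] G) :
    TensorPowerHilbert d H →L[ℝ] TensorPowerHilbert d G :=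
  (AlgTensorPower.mapL d S).completion

theorem tensorPowerOp_simpleTensor {d : ℕ} (S : H →L[ℝ] G) (f : Fin d → H) :
    tensorPowerOp d S (simpleTensor f) = simpleTensor fun l => S (f l) := by
  simp only [tensorPowerOp, simpleTensor, ContinuousLinearMap.completion_apply_coe]
  exact congrArg _ (AlgTensorPower.map_tprod _ _)

/-- The operator on `H_d` with `⊗ f ↦ ⊗ (f ∘ π)`. -/
def permOp {d : ℕ} (π : Equiv.Perm (Fin d)) :
    TensorPowerHilbert d H →L[ℝ] TensorPowerHilbert d H :=
  (AlgTensorPower.permL π).completion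

theorem permOp_simpleTensor {d : ℕ} (π : Equiv.Perm (Fin d)) (f : Fin d → H) :
    permOp π (simpleTensor f) = simpleTensor (f ∘ π) := by
  simp only [permOp, simpleTensor, ContinuousLinearMap.completion_apply_coe]
  exact congrArg _ (AlgTensorPower.perm_tprod _ _)

/-- The set `𝒮_I` of the permutations of the coordinates that fix the complement of `I`
pointwise. -/
def permsOf {d : ℕ} (I : Finset (Fin d)) : Finset (Equiv.Perm (Fin d)) :=
  Finset.univ.filter fun π => ∀ i, i ∉ I → π i = i

/-- The antisymmetrizer `𝔄_I = (#𝒮_I)⁻¹ ∑ π ∈ 𝒮_I, (-1)^|π| π` on `H_d`. -/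
def antisymmetrizer {d : ℕ} (H : Type*) [NormedAddCommGroup H] [InnerProductSpace ℝ H]
    (I : Finset (Fin d)) : TensorPowerHilbert d H →L[ℝ] TensorPowerHilbert d H :=
  ((permsOf I).card : ℝ)⁻¹ • ∑ π ∈ permsOf I, ((Equiv.Perm.sign π : ℤ) : ℝ) • permOp π

/-- The subspace `𝔄_I(H_d)` of the `I`-antisymmetric elements of `H_d`. -/
def antisymSubspace {d : ℕ} (H : Type*) [NormedAddCommGroup H] [InnerProductSpace ℝ H]
    (I : Finset (Fin d)) : Submodule ℝ (TensorPowerHilbert d H) :=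
  LinearMap.range (antisymmetrizer H I).toLinearMap

end Problem

/-! ### Algorithms, minimal errors and information complexity -/

/-- The values `y v = L_v(f; y 0, …, y (v - 1))` computed by adaptive information. -/
def adaptiveInfo {F : Type*} [NormedAddCommGroup F] [NormedSpace ℝ F]
    (L : (v : ℕ) → (Fin v → ℝ) → (F →L[ℝ] ℝ)) (f : F) (v : ℕ) : ℝ :=
  L v (fun j : Fin v => adaptiveInfo L f j) f
termination_by v
decreasing_by exact j.2

/-- The algorithms `A = φ ∘ N` on `F` that use `n` pieces of information: `N f = (y 0, …, y (n-1))`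
consists of `n` adaptively chosen continuous linear functionals, and `φ : ℝⁿ → Y` is arbitrary. -/
def IsAdaptiveAlgorithm {F Y : Type*} [NormedAddCommGroup F] [NormedSpace ℝ F]
    (n : ℕ) (A : F → Y) : Prop :=
  ∃ (L : (v : ℕ) → (Fin v → ℝ) → (F →L[ℝ] ℝ)) (φ : (Fin n → ℝ) → Y),
    ∀ f, A f = φ fun v : Fin n => adaptiveInfo L f v

section Errors

variable {F Y : Type*} [NormedAddCommGroup F] [NormedSpace ℝ F]
  [NormedAddCommGroup Y] [NormedSpace ℝ Y]

/-- The worst case error of `A` as an approximation of `T` on the unit ball of `F`. -/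
def worstCaseError (T : F →L[ℝ] Y) (A : F → Y) : ℝ≥0∞ :=
  ⨆ (f : F) (_ : ‖f‖ ≤ 1), ENNReal.ofReal ‖A f - T f‖

/-- The `n`-th minimal worst case error of the problem `T`. -/
def minimalError (T : F →L[ℝ] Y) (n : ℕ) : ℝ≥0∞ :=
  ⨅ (A : F → Y) (_ : IsAdaptiveAlgorithm n A), worstCaseError T A

/-- The information complexity: the least `n` such that the `n`-th minimal error is at most `ε`
(and `⊤` if there is no such `n`). -/
def infoComplexity (T : F →L[ℝ] Y) (ε : ℝ) : ℕ∞ :=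
  ⨅ (n : ℕ) (_ : minimalError T n ≤ ENNReal.ofReal ε), (n : ℕ∞)

end Errors

/-! ### The antisymmetric tensor product problem -/

section Antisymmetric

variable {H G : Type*} [NormedAddCommGroup H] [InnerProductSpace ℝ H]
  [NormedAddCommGroup G] [InnerProductSpace ℝ G]

/-- The `I`-antisymmetric problem: the restriction of `S_d` to `𝔄_I(H_d)`. -/
def antisymProblem {d : ℕ} (S : H →L[ℝ] G) (I : Finset (Fin d)) :
    antisymSubspace H I →L[ℝ] TensorPowerHilbert d G :=
  tensorPowerOp d S ∘L (antisymSubspace H I).subtypeL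

/-- The initial error of the `I`-antisymmetric problem. -/
def antisymInitialError {d : ℕ} (S : H →L[ℝ] G) (I : Finset (Fin d)) : ℝ≥0∞ :=
  minimalError (antisymProblem S I) 0

/-- Polynomial tractability of the `I_d`-antisymmetric problems `(S_d)_{d ≥ 1}` with respect to the
absolute error criterion, with the constants `C`, `p` and `q`. -/
def AntisymPolyTractable (S : H →L[ℝ] G) (I : (d : ℕ) → Finset (Fin d)) (C p q : ℝ) : Prop :=
  ∀ d : ℕ, 1 ≤ d → ∀ ε : ℝ, 0 < ε → ε ≤ 1 →
    (infoComplexity (antisymProblem S (I d)) ε : ℝ≥0∞)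
      ≤ ENNReal.ofReal (C * ε ^ (-p) * (d : ℝ) ^ q)

/-- `lam` is the non-increasing sequence of the eigenvalues of the compact positive operator `W`,
counted with multiplicity (the positive ones, followed by zeros if there are only finitely many):
`lam` is non-increasing, non-negative, there are orthonormal eigenvectors `e i` for the
indices `i` with `lam i > 0`, and `W` vanishes on the orthogonal complement of these. -/
def IsEigenvalueSequence (W : H →L[ℝ] H) (lam : ℕ → ℝ) : Prop :=
  Antitone lam ∧ (∀ i, 0 ≤ lam i) ∧
    ∃ e : {i : ℕ // 0 < lam i} → H, Orthonormal ℝ e ∧ (∀ i, W (e i) = lam i • e i) ∧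
      ∀ x : H, (∀ i, inner ℝ (e i) x = 0) → W x = 0

end Antisymmetric

end

/-! Let `a` be the size of `I_d` and `P_d = lam 0 ^ (d - a) * ∏ i < a, lam i`. Antisymmetrized
tensor products of eigenvectors, one per orbit of multi-indices injective on `I_d`, are orthogonal
with equal lengths. Their images under `S_d` are orthogonal too, with squared norms scaled by the
products of the eigenvalues. A null-space argument, valid for adaptive algorithms, shows that `n(ε,
d)` is at least the number of such products above `ε²` (`card_le_infoComplexity_antisymProblem`).

Tractability thus bounds this counting function, and dyadic summation gives, for `τ > p/2`, that the
`τ`-th powers of the products sum to at most `C d^q (P_d^τ + K)`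
(`AntisymPolyTractable.sum_prod_rpow_le`). For `d = 1` this is summability of `lam^τ`. For general
`d`, fixing the coordinates in `I_d` to `0, …, a - 1` and leaving the others free yields `(∏ i < a,
lam i^τ) * N^(d - a) ≤ C d^q (P_d^τ + K)`, where `N` is any partial sum of `lam^τ`.

With two terms in `N`, this forces `P_d` to decay exponentially up to a polynomial: either `a ≥ d/2`
and the small eigenvalues dominate, or `d - a ≥ d/2` and `(1 + μ₁/μ₀)^(d - a)`, with `μᵢ = lam i^τ`,
beats `C d^q`. Repeated indices in `I_d` are invisible to antisymmetric elements, so the initial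
error is at most `√P_d`, which gives the first claim. The second follows by taking logarithms once
`P_d ≤ 1`. For the third, `lam 0 ≥ 1` and `a` bounded along a subsequence would keep `P_d` away from
zero. -/

/-! ### Lower bounds against adaptive algorithms -/

theorem adaptiveInfo_eq_zero {F : Type*} [NormedAddCommGroup F] [NormedSpace ℝ F]
    (L : (v : ℕ) → (Fin v → ℝ) → (F →L[ℝ] ℝ)) (f : F) (n : ℕ) (h : ∀ v < n, L v 0 f = 0)
    (v : ℕ) (hv : v < n) : adaptiveInfo L f v = 0 := by
  induction v using Nat.strong_induction_on with
  | _ v ih =>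
    have e : (fun j : Fin v => adaptiveInfo L f j) = 0 :=
      funext fun j => ih j j.2 (j.2.trans hv)
    rw [adaptiveInfo, e, h v hv]

/-- A subspace of dimension larger than `n` on which `T` is bounded below by `s` bounds the
`n`-th minimal error from below. -/
theorem ofReal_le_minimalError {F Y κ : Type*} [NormedAddCommGroup F] [NormedSpace ℝ F]
    [NormedAddCommGroup Y] [NormedSpace ℝ Y] [Fintype κ] (T : F →L[ℝ] Y) (n : ℕ)
    (hn : n < Fintype.card κ) (s : ℝ) (v : κ → F) (hv : LinearIndependent ℝ v)
    (h : ∀ c : κ → ℝ, s * ‖∑ i, c i • v i‖ ≤ ‖T (∑ i, c i • v i)‖) :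
    ENNReal.ofReal s ≤ minimalError T n := by
  refine le_iInf₂ fun A hA => ?_
  obtain ⟨L, φ, hA⟩ := hA
  -- Only the functionals selected after all-zero answers matter, which makes the adaptive
  -- information linear here; more unknowns than equations give a nonzero kernel vector.
  let M : (κ → ℝ) →ₗ[ℝ] (Fin n → ℝ) :=
    LinearMap.pi fun j => (L j 0).toLinearMap ∘ₗ Fintype.linearCombination ℝ v
  have hker : LinearMap.ker M ≠ ⊥ := LinearMap.ker_ne_bot_of_finrank_lt (by simpa using hn)
  obtain ⟨c, hc, hc0⟩ := (Submodule.ne_bot_iff _).1 hker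
  set f : F := ∑ i, c i • v i with hf
  have hf0 : f ≠ 0 := fun h0 => hc0 (funext fun i =>
    Fintype.linearIndependent_iff.1 hv c h0 i)
  have hLf : ∀ j < n, L j 0 f = 0 := fun j hj => by
    have := congrFun (LinearMap.mem_ker.1 hc) ⟨j, hj⟩
    simpa [M, Fintype.linearCombination_apply, hf] using this
  set g : F := ‖f‖⁻¹ • f with hg
  have hfn : 0 < ‖f‖ := norm_pos_iff.2 hf0
  have hg1 : ‖g‖ = 1 := by rw [hg, norm_smul, norm_inv, norm_norm, inv_mul_cancel₀ hfn.ne']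
  have hTg : s ≤ ‖T g‖ := by
    rw [hg, map_smul, norm_smul, norm_inv, norm_norm, inv_mul_eq_div, le_div_iff₀ hfn]
    exact h c
  have hLg : ∀ j < n, L j 0 g = 0 := fun j hj => by simp [hg, hLf j hj]
  have hLg' : ∀ j < n, L j 0 (-g) = 0 := fun j hj => by simp [hLg j hj]
  have e : A (-g) = A g := by
    rw [hA, hA]
    congr 1
    funext j
    rw [adaptiveInfo_eq_zero L _ n hLg' j j.2, adaptiveInfo_eq_zero L _ n hLg j j.2]
  -- The algorithm cannot distinguish `g` from `-g`, so it errs by at least `‖T g‖` on one of them.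
  have h2 : 2 * ‖T g‖ ≤ ‖A g - T g‖ + ‖A (-g) - T (-g)‖ := by
    have h3 := norm_sub_le (A (-g) - T (-g)) (A g - T g)
    have e3 : A (-g) - T (-g) - (A g - T g) = (2 : ℝ) • T g := by
      rw [e, map_neg, two_smul]; abel
    rw [e3, norm_smul, Real.norm_ofNat] at h3
    linarith
  rcases le_total ‖T g‖ ‖A g - T g‖ with h4 | h4
  · exact (ENNReal.ofReal_le_ofReal (hTg.trans h4)).trans
      (le_iSup₂ (f := fun (f : F) (_ : ‖f‖ ≤ 1) => ENNReal.ofReal ‖A f - T f‖) g hg1.le)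
  · exact (ENNReal.ofReal_le_ofReal (show s ≤ ‖A (-g) - T (-g)‖ by linarith)).trans
      (le_iSup₂ (f := fun (f : F) (_ : ‖f‖ ≤ 1) => ENNReal.ofReal ‖A f - T f‖) (-g)
        (by rw [norm_neg, hg1]))

theorem norm_sum_smul_sq_of_orthogonal {E κ : Type*} [NormedAddCommGroup E]
    [InnerProductSpace ℝ E] (s : Finset κ) [DecidableEq κ] (v : κ → E) (N : κ → ℝ)
    (h : ∀ i ∈ s, ∀ j ∈ s, inner ℝ (v i) (v j) = if i = j then N i else 0) (c : κ → ℝ) :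
    ‖∑ i ∈ s, c i • v i‖ ^ 2 = ∑ i ∈ s, c i ^ 2 * N i := by
  rw [← real_inner_self_eq_norm_sq, sum_inner]
  refine Finset.sum_congr rfl fun i hi => ?_
  rw [inner_sum]
  have : ∀ j ∈ s, inner ℝ (c i • v i) (c j • v j) = if i = j then c i ^ 2 * N i else 0 := by
    intro j hj
    rw [real_inner_smul_left, real_inner_smul_right, h i hi j hj]
    split_ifs with hij
    · subst hij; ring
    · simp
  rw [Finset.sum_congr rfl this]
  simp [hi]

/-- By Pythagoras, `T` stretches every vector of the span by at least the square root of the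
smallest `w i`. The family is finite, so this minimum is attained and still exceeds `ε²` strictly;
fewer than `card κ` functionals therefore cannot reach error `ε`. -/
theorem card_le_infoComplexity {F Y κ : Type*} [NormedAddCommGroup F] [InnerProductSpace ℝ F]
    [NormedAddCommGroup Y] [InnerProductSpace ℝ Y] [Fintype κ] [DecidableEq κ] (T : F →L[ℝ] Y)
    (ε : ℝ) (hε : 0 ≤ ε) (v : κ → F) (N : ℝ) (hN : 0 < N) (w : κ → ℝ)
    (hv : ∀ i j, inner ℝ (v i) (v j) = if i = j then N else 0)
    (hTv : ∀ i j, inner ℝ (T (v i)) (T (v j)) = if i = j then N * w i else 0)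
    (hw : ∀ i, ε ^ 2 < w i) : (Fintype.card κ : ℕ∞) ≤ infoComplexity T ε := by
  refine le_iInf₂ fun n hn => ?_
  by_contra! hlt
  have hlt : n < Fintype.card κ := by exact_mod_cast hlt
  have : Nonempty κ := Fintype.card_pos_iff.1 (by omega)
  obtain ⟨i₀, hi₀⟩ := Finite.exists_min w
  have hnv : ∀ c : κ → ℝ, ‖∑ i, c i • v i‖ ^ 2 = ∑ i, c i ^ 2 * N := fun c =>
    norm_sum_smul_sq_of_orthogonal Finset.univ v (fun _ => N) (fun i _ j _ => hv i j) c
  have hnT : ∀ c : κ → ℝ, ‖T (∑ i, c i • v i)‖ ^ 2 = ∑ i, c i ^ 2 * (N * w i) := fun c => by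
    rw [map_sum]
    simp_rw [map_smul]
    exact norm_sum_smul_sq_of_orthogonal Finset.univ (fun i => T (v i)) (fun i => N * w i)
      (fun i _ j _ => hTv i j) c
  have hw0 : 0 ≤ w i₀ := (sq_nonneg ε).trans (hw i₀).le
  have key := ofReal_le_minimalError T n hlt (√(w i₀)) v (by
    rw [Fintype.linearIndependent_iff]
    intro c hc i
    have h := hnv c
    rw [hc, norm_zero, zero_pow two_ne_zero, eq_comm,
      Finset.sum_eq_zero_iff_of_nonneg fun i _ => by positivity] at h
    have := h i (Finset.mem_univ i)
    simpa [hN.ne'] using this) (fun c => by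
    refine le_of_sq_le_sq ?_ (norm_nonneg _)
    rw [mul_pow, Real.sq_sqrt hw0, hnv, hnT, Finset.mul_sum]
    refine Finset.sum_le_sum fun i _ => ?_
    have := mul_le_mul_of_nonneg_left (hi₀ i) (show 0 ≤ c i ^ 2 * N by positivity)
    linarith)
  have h1 := key.trans hn
  rw [ENNReal.ofReal_le_ofReal_iff hε] at h1
  exact absurd (hw i₀) (not_lt.2 ((Real.sqrt_le_left hε).1 h1))

/-! ### Permutation action and antisymmetrization -/

section Antisymmetrizer

variable {H G : Type*} [NormedAddCommGroup H] [InnerProductSpace ℝ H]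
  [NormedAddCommGroup G] [InnerProductSpace ℝ G] {d : ℕ}

theorem mem_permsOf {I : Finset (Fin d)} {π : Equiv.Perm (Fin d)} :
    π ∈ permsOf I ↔ ∀ i, i ∉ I → π i = i := by
  simp [permsOf]

theorem one_mem_permsOf (I : Finset (Fin d)) : 1 ∈ permsOf I :=
  mem_permsOf.2 fun _ _ => rfl

theorem mul_mem_permsOf {I : Finset (Fin d)} {π σ : Equiv.Perm (Fin d)} (hπ : π ∈ permsOf I)
    (hσ : σ ∈ permsOf I) : π * σ ∈ permsOf I :=
  mem_permsOf.2 fun i hi => by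
    rw [Equiv.Perm.mul_apply, mem_permsOf.1 hσ i hi, mem_permsOf.1 hπ i hi]

theorem inv_mem_permsOf {I : Finset (Fin d)} {π : Equiv.Perm (Fin d)} (hπ : π ∈ permsOf I) :
    π⁻¹ ∈ permsOf I :=
  mem_permsOf.2 fun i hi => by
    rw [Equiv.Perm.inv_eq_iff_eq, mem_permsOf.1 hπ i hi]

theorem swap_mem_permsOf {I : Finset (Fin d)} {i j : Fin d} (hi : i ∈ I) (hj : j ∈ I) :
    Equiv.swap i j ∈ permsOf I :=
  mem_permsOf.2 fun _ hl =>
    Equiv.swap_apply_of_ne_of_ne (fun h => hl (h ▸ hi)) (fun h => hl (h ▸ hj))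

theorem card_permsOf_pos (I : Finset (Fin d)) : 0 < ((permsOf I).card : ℝ) :=
  Nat.cast_pos.2 (Finset.card_pos.2 ⟨1, one_mem_permsOf I⟩)

theorem antisymmetrizer_simpleTensor (I : Finset (Fin d)) (f : Fin d → H) :
    antisymmetrizer H I (simpleTensor f) = ((permsOf I).card : ℝ)⁻¹ •
      ∑ π ∈ permsOf I, ((Equiv.Perm.sign π : ℤ) : ℝ) • simpleTensor (f ∘ π) := by
  simp [antisymmetrizer, permOp_simpleTensor]

theorem tensorPowerOp_antisymmetrizer_simpleTensor (S : H →L[ℝ] G) (I : Finset (Fin d))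
    (f : Fin d → H) :
    tensorPowerOp d S (antisymmetrizer H I (simpleTensor f))
      = antisymmetrizer G I (simpleTensor fun l => S (f l)) := by
  rw [antisymmetrizer_simpleTensor, antisymmetrizer_simpleTensor]
  simp only [map_smul, map_sum, tensorPowerOp_simpleTensor]
  rfl

theorem inner_simpleTensor_of_orthogonal {ι : Type*} [DecidableEq ι] (v : ι → H) (c : ι → ℝ)
    (hv : ∀ i j, inner ℝ (v i) (v j) = if i = j then c i else 0) (k k' : Fin d → ι) :
    inner ℝ (simpleTensor (v ∘ k)) (simpleTensor (v ∘ k'))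
      = if k = k' then ∏ l, c (k l) else 0 := by
  rw [inner_simpleTensor]
  split_ifs with h
  · subst h
    exact Finset.prod_congr rfl fun l _ => by simp only [Function.comp_apply, hv, if_true]
  · obtain ⟨l, hl⟩ := Function.ne_iff.1 h
    exact Finset.prod_eq_zero (Finset.mem_univ l) (by
      simp only [Function.comp_apply, hv, hl, if_false])

/-- Antisymmetrizations of simple tensors of members of an orthogonal family are orthogonal. -/
theorem inner_antisymmetrizer_of_orthogonal {ι : Type*} [DecidableEq ι] (v : ι → H) (c : ι → ℝ)
    (hv : ∀ i j, inner ℝ (v i) (v j) = if i = j then c i else 0) (I : Finset (Fin d))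
    (k k' : Fin d → ι) (hk : ∀ π ∈ permsOf I, k ∘ π = k' → π = 1) :
    inner ℝ (antisymmetrizer H I (simpleTensor (v ∘ k)))
        (antisymmetrizer H I (simpleTensor (v ∘ k')))
      = if k = k' then ((permsOf I).card : ℝ)⁻¹ * ∏ l, c (k l) else 0 := by
  have hN := card_permsOf_pos I
  have key : ∀ π ∈ permsOf I, ∀ σ ∈ permsOf I,
      inner ℝ (((Equiv.Perm.sign π : ℤ) : ℝ) • simpleTensor ((v ∘ k) ∘ π))
        (((Equiv.Perm.sign σ : ℤ) : ℝ) • simpleTensor ((v ∘ k') ∘ σ))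
      = if π = σ then (if k = k' then ∏ l, c (k l) else 0) else 0 := by
    intro π hπ σ hσ
    rw [real_inner_smul_left, real_inner_smul_right, Function.comp_assoc, Function.comp_assoc,
      inner_simpleTensor_of_orthogonal v c hv]
    by_cases h : k ∘ π = k' ∘ σ
    -- A nonzero pairing puts `k` and `k'` in one orbit, where `hk` forces `π = σ` and `k = k'`.
    -- Only the diagonal of the double sum survives, hence one inverse cardinality in place of two.
    · have h1 : k ∘ (π * σ⁻¹ : Equiv.Perm (Fin d)) = k' := by
        funext l
        have := congrFun h (σ⁻¹ l)
        simpa using this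
      have h2 := hk _ (mul_mem_permsOf hπ (inv_mem_permsOf hσ)) h1
      have h3 : π = σ := mul_inv_eq_one.1 h2
      subst h3
      have h4 : k = k' := by simpa using h1
      subst h4
      have h5 : ((Equiv.Perm.sign π : ℤ) : ℝ) * ((Equiv.Perm.sign π : ℤ) : ℝ) = 1 := by
        rcases Int.units_eq_one_or (Equiv.Perm.sign π) with h | h <;> simp [h]
      simp only [if_true, Function.comp_apply]
      rw [Equiv.prod_comp π fun l => c (k l), ← mul_assoc, h5, one_mul]
    · rw [if_neg h]
      by_cases h3 : π = σ
      · subst h3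
        have : k ≠ k' := fun e => h (by rw [e])
        simp [this]
      · simp [h3]
  rw [antisymmetrizer_simpleTensor, antisymmetrizer_simpleTensor, real_inner_smul_left,
    real_inner_smul_right, sum_inner]
  simp_rw [inner_sum]
  rw [Finset.sum_congr rfl fun π hπ => Finset.sum_congr rfl fun σ hσ => key π hπ σ hσ]
  rw [Finset.sum_congr rfl fun π hπ => Finset.sum_ite_eq _ π _]
  split_ifs with h
  · simp only [Finset.sum_const, nsmul_eq_mul]
    field_simp
  · simp

theorem mem_closure_span_simpleTensor (x : TensorPowerHilbert d H) :
    x ∈ closure (Submodule.span ℝ (Set.range (simpleTensor (H := H) (d := d))) :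
      Set (TensorPowerHilbert d H)) := by
  refine UniformSpace.Completion.induction_on x isClosed_closure fun a => subset_closure ?_
  obtain ⟨c, rfl⟩ := AlgTensorPower.exists_finsupp a
  have : ((c.sum fun f a => a • AlgTensorPower.tprod d H f : AlgTensorPower d H) :
      TensorPowerHilbert d H) = c.sum fun f a => a • simpleTensor f := by
    have h := map_finsuppSum (UniformSpace.Completion.toComplL (𝕜 := ℝ) (E := AlgTensorPower d H))
      c (fun f a => a • AlgTensorPower.tprod d H f)
    simpa [simpleTensor] using h
  rw [this]
  exact Submodule.sum_mem _ fun f _ =>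
    Submodule.smul_mem _ _ (Submodule.subset_span ⟨f, rfl⟩)

theorem continuousLinearMap_eq_of_simpleTensor {E : Type*} [NormedAddCommGroup E]
    [NormedSpace ℝ E] (A B : TensorPowerHilbert d H →L[ℝ] E)
    (h : ∀ f : Fin d → H, A (simpleTensor f) = B (simpleTensor f)) : A = B := by
  ext x
  have hx := mem_closure_span_simpleTensor x
  have hsub : (Submodule.span ℝ (Set.range (simpleTensor (H := H) (d := d))) :
      Set (TensorPowerHilbert d H)) ⊆ {x | A x = B x} := by
    have : Submodule.span ℝ (Set.range (simpleTensor (H := H) (d := d)))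
        ≤ LinearMap.eqLocus A.toLinearMap B.toLinearMap := by
      rw [Submodule.span_le]
      rintro _ ⟨f, rfl⟩
      exact h f
    exact this
  exact closure_minimal hsub (isClosed_eq A.continuous B.continuous) hx

/-- Permutations act by precomposition, which is a right action; hence the reversed order. -/
theorem permOp_comp_permOp (π σ : Equiv.Perm (Fin d)) (x : TensorPowerHilbert d H) :
    permOp σ (permOp π x) = permOp (π * σ) x := by
  have : (permOp σ ∘L permOp π : TensorPowerHilbert d H →L[ℝ] _) = permOp (π * σ) := by
    refine continuousLinearMap_eq_of_simpleTensor _ _ fun f => ?_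
    simp only [ContinuousLinearMap.comp_apply, permOp_simpleTensor]
    rfl
  exact congrArg (fun A => A x) this

theorem permOp_swap_antisymmetrizer {I : Finset (Fin d)} {i j : Fin d} (hi : i ∈ I) (hj : j ∈ I)
    (hij : i ≠ j) (x : TensorPowerHilbert d H) :
    permOp (Equiv.swap i j) (antisymmetrizer H I x) = -antisymmetrizer H I x := by
  have hs := swap_mem_permsOf hi hj
  simp only [antisymmetrizer, smul_apply, sum_apply,
    map_smul, map_sum, permOp_comp_permOp]
  rw [← smul_neg, ← Finset.sum_neg_distrib]
  congr 1
  refine Finset.sum_nbij' (fun π => π * Equiv.swap i j) (fun π => π * Equiv.swap i j)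
    (fun π hπ => mul_mem_permsOf hπ hs) (fun π hπ => mul_mem_permsOf hπ hs)
    (fun π _ => by simp [mul_assoc]) (fun π _ => by simp [mul_assoc]) fun π _ => ?_
  simp [Equiv.Perm.sign_swap hij]

theorem inner_permOp_simpleTensor (π : Equiv.Perm (Fin d)) (f : Fin d → H)
    (x : TensorPowerHilbert d H) :
    inner ℝ (simpleTensor (f ∘ π)) (permOp π x) = inner ℝ (simpleTensor f) x := by
  have : (innerSL ℝ (simpleTensor (f ∘ π)) ∘L permOp π) = innerSL ℝ (simpleTensor f) := by
    refine continuousLinearMap_eq_of_simpleTensor _ _ fun g => ?_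
    simp only [ContinuousLinearMap.comp_apply, permOp_simpleTensor, innerSL_apply_apply,
      inner_simpleTensor, Function.comp_apply]
    exact Equiv.prod_comp π fun l => inner ℝ (f l) (g l)
  exact congrArg (fun A => A x) this

/-- The swap of `i` and `j` preserves inner products, fixes the simple tensor and negates the
antisymmetric element, so the inner product equals its own negative. This is the exclusion principle
that removes indices repeated in `I`. -/
theorem inner_simpleTensor_antisymmetrizer_eq_zero {I : Finset (Fin d)} {i j : Fin d}
    (hi : i ∈ I) (hj : j ∈ I) (hij : i ≠ j) (f : Fin d → H) (hf : f i = f j)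
    (x : TensorPowerHilbert d H) :
    inner ℝ (simpleTensor f) (antisymmetrizer H I x) = 0 := by
  have h := inner_permOp_simpleTensor (Equiv.swap i j) f (antisymmetrizer H I x)
  have e : f ∘ Equiv.swap i j = f := by
    funext l
    simp only [Function.comp_apply, Equiv.swap_apply_def]
    split_ifs with h1 h2
    · rw [h1, hf]
    · rw [h2, hf]
    · rfl
  rw [e, permOp_swap_antisymmetrizer hi hj hij, inner_neg_right] at h
  linarith

theorem norm_simpleTensor (f : Fin d → H) : ‖simpleTensor f‖ = ∏ l, ‖f l‖ := by
  refine (sq_eq_sq₀ (norm_nonneg _) (Finset.prod_nonneg fun _ _ => norm_nonneg _)).1 ?_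
  rw [← real_inner_self_eq_norm_sq, inner_simpleTensor, ← Finset.prod_pow]
  simp_rw [real_inner_self_eq_norm_sq]

/-- `simpleTensor` as a continuous multilinear map. -/
noncomputable def simpleTensorMultilinear (d : ℕ) (H : Type*) [NormedAddCommGroup H]
    [InnerProductSpace ℝ H] :
    ContinuousMultilinearMap ℝ (fun _ : Fin d => H) (TensorPowerHilbert d H) :=
  ((UniformSpace.Completion.toComplL (𝕜 := ℝ)
    (E := AlgTensorPower d H)).toLinearMap.compMultilinearMap
      (AlgTensorPower.tprod d H)).mkContinuous 1 fun f => by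
    rw [one_mul]
    exact (norm_simpleTensor f).le

end Antisymmetrizer

/-! ### Spectral expansion and norm bounds -/

section UpperBound

variable {H G : Type*} [NormedAddCommGroup H] [InnerProductSpace ℝ H]
  [NormedAddCommGroup G] [InnerProductSpace ℝ G] {d : ℕ}

/-- The family `e` need not be complete: `x` minus its projection is orthogonal to every `e i`,
hence killed by `S`. -/
theorem hasSum_inner_smul_map_of_ker [CompleteSpace H] {ι : Type*} {e : ι → H}
    (he : Orthonormal ℝ e) (S : H →L[ℝ] G) (hS : ∀ x, (∀ i, inner ℝ (e i) x = 0) → S x = 0)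
    (x : H) : HasSum (fun i => (inner ℝ (e i) x : ℝ) • S (e i)) (S x) := by
  have hsum : Summable fun i => (inner ℝ (e i) x : ℝ) • e i := by
    have h := (he.orthogonalFamily.summable_iff_norm_sq_summable
      fun i => (inner ℝ (e i) x : ℝ)).2 (he.inner_products_summable x)
    simpa using h
  obtain ⟨y, hy⟩ := hsum
  have hxy : S (x - y) = 0 := hS _ fun j => by
    have h1 := (innerSL ℝ (e j)).hasSum hy
    have h2 : HasSum (fun i => innerSL ℝ (e j) ((inner ℝ (e i) x : ℝ) • e i))
        (inner ℝ (e j) x) := by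
      have h3 := hasSum_single (f := fun i => innerSL ℝ (e j) ((inner ℝ (e i) x : ℝ) • e i)) j
        fun i hi => by
          simp [he.2 hi.symm]
      simpa [inner_smul_right, he.1 j, real_inner_self_eq_norm_sq] using h3
    rw [inner_sub_right, h2.unique h1]
    simp
  rw [map_sub, sub_eq_zero] at hxy
  rw [hxy]
  simpa using S.hasSum hy

theorem orthonormal_simpleTensor {ι : Type*} {e : ι → H} (he : Orthonormal ℝ e) :
    Orthonormal ℝ fun k : Fin d → ι => simpleTensor (e ∘ k) := by
  classical
  rw [orthonormal_iff_ite] at he ⊢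
  intro k k'
  rw [inner_simpleTensor_of_orthogonal e (fun _ => 1) he]
  simp

/-- On simple tensors the sum over the box `J^d` factors by multilinearity into one-dimensional
expansions. Bessel's inequality makes the partial sums equicontinuous, so the set where they
converge to the right limit is closed, and simple tensors span a dense subspace. -/
theorem tendsto_sum_inner_smul_tensorPowerOp [CompleteSpace H] {ι : Type*} {e : ι → H}
    (he : Orthonormal ℝ e) (S : H →L[ℝ] G) (hS : ∀ x, (∀ i, inner ℝ (e i) x = 0) → S x = 0)
    (x : TensorPowerHilbert d H) :
    Tendsto (fun J : Finset ι => ∑ k ∈ Fintype.piFinset fun _ : Fin d => J,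
      (inner ℝ (simpleTensor (e ∘ k)) x : ℝ) • simpleTensor fun l => S (e (k l)))
      atTop (𝓝 (tensorPowerOp d S x)) := by
  classical
  have hod : Orthonormal ℝ fun k : Fin d → ι => simpleTensor (e ∘ k) :=
    orthonormal_simpleTensor he
  have hF : ∀ (J : Finset ι) (x : TensorPowerHilbert d H),
      (∑ k ∈ Fintype.piFinset fun _ : Fin d => J,
        (inner ℝ (simpleTensor (e ∘ k)) x : ℝ) • simpleTensor fun l => S (e (k l)))
      = tensorPowerOp d S (∑ k ∈ Fintype.piFinset fun _ : Fin d => J,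
        (inner ℝ (simpleTensor (e ∘ k)) x : ℝ) • simpleTensor (e ∘ k)) := by
    intro J x
    simp only [map_sum, map_smul, tensorPowerOp_simpleTensor, Function.comp_apply]
  have hproj : ∀ (J : Finset ι) (x : TensorPowerHilbert d H),
      ‖∑ k ∈ Fintype.piFinset fun _ : Fin d => J,
        (inner ℝ (simpleTensor (e ∘ k)) x : ℝ) • simpleTensor (e ∘ k)‖ ≤ ‖x‖ := by
    intro J x
    refine le_of_sq_le_sq ?_ (norm_nonneg _)
    rw [norm_sum_smul_sq_of_orthogonal _ _ (fun _ => 1)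
      (fun i _ j _ => orthonormal_iff_ite.1 hod i j)]
    have := hod.sum_inner_products_le x (s := Fintype.piFinset fun _ : Fin d => J)
    simpa using this
  have hequi : Equicontinuous fun (J : Finset ι) (x : TensorPowerHilbert d H) =>
      ∑ k ∈ Fintype.piFinset fun _ : Fin d => J,
        (inner ℝ (simpleTensor (e ∘ k)) x : ℝ) • simpleTensor fun l => S (e (k l)) := by
    refine Metric.equicontinuous_of_continuity_modulus
      (fun t => ‖tensorPowerOp d S‖ * t) ?_ _ fun x y J => ?_
    · have : Continuous fun t : ℝ => ‖tensorPowerOp d S‖ * t := by fun_prop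
      simpa using this.tendsto 0
    · rw [hF, hF, dist_eq_norm, dist_eq_norm, ← map_sub, ← Finset.sum_sub_distrib]
      simp_rw [← sub_smul, ← inner_sub_right]
      exact (tensorPowerOp d S).le_opNorm_of_le (hproj J _)
  have hclosed := hequi.isClosed_setOfPred_tendsto (l := atTop) (tensorPowerOp d S).continuous
  refine closure_minimal ?_ hclosed (mem_closure_span_simpleTensor x)
  intro y hy
  simp only [Set.mem_ofPred_eq]
  refine Submodule.span_induction (p := fun y _ => Tendsto (fun J : Finset ι =>
      ∑ k ∈ Fintype.piFinset fun _ : Fin d => J,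
      (inner ℝ (simpleTensor (e ∘ k)) y : ℝ) • simpleTensor fun l => S (e (k l)))
      atTop (𝓝 (tensorPowerOp d S y))) ?_ ?_ ?_ ?_ hy
  · rintro _ ⟨f, rfl⟩
    have h1 : Tendsto (fun J : Finset ι => fun l : Fin d =>
        ∑ i ∈ J, (inner ℝ (e i) (f l) : ℝ) • S (e i)) atTop (𝓝 fun l => S (f l)) :=
      tendsto_pi_nhds.2 fun l => hasSum_inner_smul_map_of_ker he S hS (f l)
    have h2 := ((simpleTensorMultilinear d G).cont.tendsto _).comp h1
    rw [tensorPowerOp_simpleTensor]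
    refine h2.congr fun J => ?_
    have h3 := (simpleTensorMultilinear d G).toMultilinearMap.map_sum_finset
      (fun (l : Fin d) i => (inner ℝ (e i) (f l) : ℝ) • S (e i)) (fun _ => J)
    refine h3.trans (Finset.sum_congr rfl fun k _ => ?_)
    rw [MultilinearMap.map_smul_univ, inner_simpleTensor]
    rfl
  · simp
  · intro x y _ _ hx hy
    rw [map_add]
    refine (hx.add hy).congr fun J => ?_
    simp_rw [inner_add_right, add_smul, Finset.sum_add_distrib]
  · intro a x _ hx
    rw [map_smul]
    refine (hx.const_smul a).congr fun J => ?_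
    simp_rw [real_inner_smul_right, mul_smul, Finset.smul_sum]

/-- The image of the expansion is orthogonal, so Pythagoras and Bessel suffice. The alternative in
`hP` lets an antisymmetric `x` ignore the products with repeated indices. -/
theorem norm_tensorPowerOp_sq_le [CompleteSpace H] {ι : Type*} [DecidableEq ι] {e : ι → H}
    (he : Orthonormal ℝ e) (S : H →L[ℝ] G) (hS : ∀ x, (∀ i, inner ℝ (e i) x = 0) → S x = 0)
    (c : ι → ℝ) (hSe : ∀ i j, inner ℝ (S (e i)) (S (e j)) = if i = j then c i else 0)
    (P : ℝ) (hP0 : 0 ≤ P) (x : TensorPowerHilbert d H)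
    (hP : ∀ k : Fin d → ι, inner ℝ (simpleTensor (e ∘ k)) x = 0 ∨ ∏ l, c (k l) ≤ P) :
    ‖tensorPowerOp d S x‖ ^ 2 ≤ P * ‖x‖ ^ 2 := by
  refine le_of_tendsto ((tendsto_sum_inner_smul_tensorPowerOp he S hS x).norm.pow 2)
    (Eventually.of_forall fun J => ?_)
  have h1 := norm_sum_smul_sq_of_orthogonal (Fintype.piFinset fun _ : Fin d => J)
    (fun k => simpleTensor ((fun i => S (e i)) ∘ k)) _
    (fun k _ k' _ => inner_simpleTensor_of_orthogonal (fun i => S (e i)) c hSe k k')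
    (fun k => inner ℝ (simpleTensor (e ∘ k)) x)
  refine h1.trans_le ?_
  have h2 := (orthonormal_simpleTensor (d := d) he).sum_inner_products_le x
    (s := Fintype.piFinset fun _ : Fin d => J)
  refine le_trans ?_ (mul_le_mul_of_nonneg_left h2 hP0)
  rw [Finset.mul_sum]
  refine Finset.sum_le_sum fun k _ => ?_
  rcases hP k with h | h
  · simp [h]
  · rw [Real.norm_eq_abs, sq_abs, mul_comm]
    gcongr

theorem minimalError_zero_le {F Y : Type*} [NormedAddCommGroup F] [NormedSpace ℝ F]
    [NormedAddCommGroup Y] [NormedSpace ℝ Y] (T : F →L[ℝ] Y) (P : ℝ) (hP : 0 ≤ P)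
    (h : ∀ x, ‖T x‖ ^ 2 ≤ P * ‖x‖ ^ 2) : minimalError T 0 ≤ ENNReal.ofReal √P := by
  refine iInf₂_le_of_le (fun _ => 0) ⟨fun _ _ => 0, fun _ => 0, fun _ => rfl⟩ ?_
  refine iSup₂_le fun f hf => ENNReal.ofReal_le_ofReal ?_
  rw [zero_sub, norm_neg]
  refine Real.le_sqrt_of_sq_le ((h f).trans ?_)
  exact mul_le_of_le_one_right hP (pow_le_one₀ (norm_nonneg _) hf)

end UpperBound

/-! ### Estimates for real sequences -/

theorem prod_le_prod_range_card {lam : ℕ → ℝ} (hanti : Antitone lam) (h0 : ∀ i, 0 ≤ lam i)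
    (s : Finset ℕ) : ∏ i ∈ s, lam i ≤ ∏ i ∈ Finset.range s.card, lam i := by
  induction s using Finset.induction_on_max with
  | empty => simp
  | insert a s hs ih =>
    have ha : a ∉ s := fun h => lt_irrefl _ (hs a h)
    rw [Finset.prod_insert ha, Finset.card_insert_of_notMem ha, Finset.prod_range_succ, mul_comm]
    -- The largest element of the set is at least the number of elements below it.
    have : s.card ≤ a := by
      have : s ⊆ Finset.range a := fun i hi => Finset.mem_range.2 (hs i hi)
      simpa using Finset.card_le_card this
    exact mul_le_mul ih (hanti this) (h0 _) (Finset.prod_nonneg fun i _ => h0 i)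

/-- Free coordinates contribute at most `lam 0` each, and distinct indices on `I` do best as an
initial segment. This identifies the bound `P_d` on the admissible eigenvalue products. -/
theorem prod_comp_le_of_injOn {lam : ℕ → ℝ} (hanti : Antitone lam) (h0 : ∀ i, 0 ≤ lam i)
    {κ : Type*} [Fintype κ] [DecidableEq κ] (I : Finset κ) (k : κ → ℕ) (hk : Set.InjOn k I) :
    ∏ l, lam (k l) ≤
      lam 0 ^ (Fintype.card κ - I.card) * ∏ i ∈ Finset.range I.card, lam i := by
  rw [← Finset.prod_compl_mul_prod I]
  refine mul_le_mul ?_ ?_ (Finset.prod_nonneg fun i _ => h0 _) (pow_nonneg (h0 0) _)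
  · rw [← Finset.card_compl, ← Finset.prod_const]
    exact Finset.prod_le_prod (fun i _ => h0 _) fun i _ => hanti (Nat.zero_le _)
  · have := prod_le_prod_range_card hanti h0 (I.image k)
    rwa [Finset.prod_image hk, Finset.card_image_of_injOn hk] at this

/-- A polynomial bound for the number of the `w i` above each level `t ≤ 1` bounds the sums
of larger powers. -/
theorem sum_rpow_le_of_card_le {α : Type*} (T : Finset α) (w : α → ℝ) (hw : ∀ i, 0 ≤ w i)
    {B σ τ M : ℝ} (hB : 0 ≤ B) (hσ : 0 < σ) (hστ : σ < τ)
    (hcard : ∀ t : ℝ, 0 < t → t ≤ 1 → ((T.filter fun i => t < w i).card : ℝ) ≤ B * t ^ (-σ))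
    (hM0 : 0 ≤ M) (hM : ∀ i ∈ T, w i ≤ M) :
    ∑ i ∈ T, w i ^ τ ≤
      B * (M ^ τ + (1 / 2 : ℝ) ^ (-σ) * (1 - (1 / 2 : ℝ) ^ (τ - σ))⁻¹) := by
  have hτ : 0 < τ := hσ.trans hστ
  set y : ℝ := 1 / 2 with hy
  have hy0 : 0 < y := by norm_num [hy]
  have hy1 : y < 1 := by norm_num [hy]
  set r : ℝ := y ^ (τ - σ) with hr
  have hr0 : 0 ≤ r := Real.rpow_nonneg hy0.le _
  have hr1 : r < 1 := Real.rpow_lt_one hy0.le hy1 (by linarith)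
  -- At most `B` terms exceed `1`, each bounded by `M ^ τ`. The rest fall into dyadic layers: at
  -- most `B * 2^((j+1)σ)` terms of size at most `2^(-jτ)`, a geometric series of ratio
  -- `2^(-(τ-σ))`.
  rw [← Finset.sum_filter_add_sum_filter_not T (fun i => 1 < w i), mul_add]
  refine add_le_add ?_ ?_
  · have h1 := hcard 1 one_pos le_rfl
    rw [Real.one_rpow, mul_one] at h1
    have h2 : ∑ i ∈ T.filter (fun i => 1 < w i), w i ^ τ
        ≤ ∑ i ∈ T.filter (fun i => 1 < w i), M ^ τ :=
      Finset.sum_le_sum fun i hi =>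
        Real.rpow_le_rpow (hw i) (hM i (Finset.mem_filter.1 hi).1) hτ.le
    rw [Finset.sum_const, nsmul_eq_mul] at h2
    exact h2.trans (mul_le_mul_of_nonneg_right h1 (Real.rpow_nonneg hM0 _))
  · set T' := T.filter (fun i => ¬ 1 < w i) with hT'
    obtain ⟨J, hJ⟩ : ∃ J : ℕ, ∀ i ∈ T, 0 < w i → y ^ J < w i := by
      have : ∀ᶠ J : ℕ in atTop, ∀ i ∈ T, 0 < w i → y ^ J < w i := by
        rw [Filter.eventually_all_finset]
        intro i _
        by_cases h : 0 < w i
        · filter_upwards [(tendsto_pow_atTop_nhds_zero_of_lt_one hy0.le hy1).eventually_lt_const h]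
            with J hJ _ using hJ
        · simp [h]
      exact this.exists
    -- The indicator omits the upper end of the layer; the overcounting is harmless and lets `hcard`
    -- apply directly.
    have h1 : ∀ i ∈ T', w i ^ τ ≤
        ∑ j ∈ Finset.range J, if y ^ (j + 1) < w i then (y ^ j) ^ τ else 0 := by
      intro i hi
      rw [hT', Finset.mem_filter, not_lt] at hi
      have hnn : ∀ j ∈ Finset.range J, 0 ≤ if y ^ (j + 1) < w i then (y ^ j) ^ τ else 0 :=
        fun j _ => by split_ifs <;> positivity
      rcases (hw i).eq_or_lt with h0 | h0
      · rw [show w i ^ τ = 0 by rw [← h0, Real.zero_rpow hτ.ne']]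
        exact Finset.sum_nonneg hnn
      · obtain ⟨n, hn1, hn2⟩ := exists_nat_pow_near_of_lt_one h0 hi.2 hy0 hy1
        have hnJ : n < J :=
          (pow_lt_pow_iff_right_of_lt_one₀ hy0 hy1).1 ((hJ i hi.1 h0).trans_le hn2)
        refine le_trans ?_ (Finset.single_le_sum hnn (Finset.mem_range.2 hnJ))
        rw [if_pos hn1]
        exact Real.rpow_le_rpow (hw i) hn2 hτ.le
    refine (Finset.sum_le_sum h1).trans ?_
    rw [Finset.sum_comm]
    have h2 : ∀ j ∈ Finset.range J, (∑ i ∈ T', if y ^ (j + 1) < w i then (y ^ j) ^ τ else 0)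
        ≤ B * y ^ (-σ) * r ^ j := by
      intro j _
      rw [← Finset.sum_filter, Finset.sum_const, nsmul_eq_mul]
      have h3 : ((T'.filter fun i => y ^ (j + 1) < w i).card : ℝ) ≤ B * (y ^ (j + 1)) ^ (-σ) := by
        refine le_trans ?_ (hcard (y ^ (j + 1)) (by positivity) (pow_le_one₀ hy0.le hy1.le))
        exact_mod_cast Finset.card_le_card (Finset.filter_subset_filter _ (Finset.filter_subset _ _))
      refine (mul_le_mul_of_nonneg_right h3 (by positivity)).trans_eq ?_
      have e1 : (y ^ (j + 1)) ^ (-σ) * (y ^ j) ^ τ = y ^ (-σ) * r ^ j := by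
        rw [hr, ← Real.rpow_natCast, ← Real.rpow_natCast, ← Real.rpow_natCast, ← Real.rpow_mul hy0.le,
          ← Real.rpow_mul hy0.le, ← Real.rpow_mul hy0.le, ← Real.rpow_add hy0, ← Real.rpow_add hy0]
        congr 1
        push_cast
        ring
      rw [mul_assoc, e1, mul_assoc]
    refine (Finset.sum_le_sum h2).trans ?_
    rw [← Finset.mul_sum, ← mul_assoc]
    refine mul_le_mul_of_nonneg_left ?_ (by positivity)
    rw [← tsum_geometric_of_lt_one hr0 hr1]
    exact (summable_geometric_of_lt_one hr0 hr1).sum_le_tsum _ fun _ _ => by positivity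

theorem tendsto_natCast_rpow_mul_exp_neg (s b : ℝ) (hb : 0 < b) :
    Tendsto (fun d : ℕ => (d : ℝ) ^ s * Real.exp (-b * d)) atTop (𝓝 0) :=
  (tendsto_rpow_mul_exp_neg_mul_atTop_nhds_zero s b hb).comp tendsto_natCast_atTop_atTop

theorem tendsto_pow_mul_sqrt_of_rpow_le {x : ℕ → ℝ} (hx : ∀ d, 0 ≤ x d) {τ M q θ : ℝ}
    (hτ : 0 < τ) (hθ : 0 < θ)
    (h : ∀ᶠ d : ℕ in atTop, x d ^ τ ≤ M * (d : ℝ) ^ q * Real.exp (-θ * d)) (k : ℕ) :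
    Tendsto (fun d : ℕ => (d : ℝ) ^ k * √(x d)) atTop (𝓝 0) := by
  have h1 : Tendsto (fun d : ℕ => (M * ((d : ℝ) ^ (2 * τ * k + q) * Real.exp (-θ * d)))
      ^ (1 / (2 * τ))) atTop (𝓝 0) := by
    have h2 := (tendsto_natCast_rpow_mul_exp_neg (2 * τ * k + q) θ hθ).const_mul M
    rw [mul_zero] at h2
    have h3 := h2.rpow_const (p := 1 / (2 * τ)) (Or.inr (by positivity))
    rwa [Real.zero_rpow (by positivity)] at h3
  refine squeeze_zero' (Eventually.of_forall fun d => by positivity) ?_ h1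
  filter_upwards [h, eventually_gt_atTop 0] with d hd hd0
  have hd0 : (0 : ℝ) < d := Nat.cast_pos.2 hd0
  -- Raising to the power `2 * τ` converts the square root into the `x d ^ τ` that is controlled.
  have e : (d : ℝ) ^ k * √(x d) = ((d : ℝ) ^ (2 * τ * k) * x d ^ τ) ^ (1 / (2 * τ)) := by
    rw [Real.mul_rpow (by positivity) (Real.rpow_nonneg (hx d) _), ← Real.rpow_mul hd0.le,
      ← Real.rpow_mul (hx d), Real.sqrt_eq_rpow, ← Real.rpow_natCast]
    congr 2 <;> field_simp
  rw [e]
  refine Real.rpow_le_rpow (mul_nonneg (by positivity) (Real.rpow_nonneg (hx d) _)) ?_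
    (by positivity)
  rw [Real.rpow_add hd0]
  refine (mul_le_mul_of_nonneg_left hd (by positivity)).trans_eq ?_
  ring

/-- At most `k₀` factors exceed `η`, each by a ratio of at most `Λ / η`. As `η ≤ Λ`, this ratio is
at least one, so the full power `k₀` is allowed even when `a < k₀`. -/
theorem prod_range_le_const_mul_pow {μ : ℕ → ℝ} (h0 : ∀ i, 0 ≤ μ i) {Λ η : ℝ}
    (hη : 0 < η) (hηΛ : η ≤ Λ) (hΛ : ∀ i, μ i ≤ Λ) (k₀ : ℕ) (hk : ∀ i, k₀ ≤ i → μ i ≤ η)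
    (a : ℕ) : ∏ i ∈ Finset.range a, μ i ≤ (Λ / η) ^ k₀ * η ^ a := by
  have h1 : ∏ i ∈ Finset.range a, μ i
      ≤ ∏ i ∈ Finset.range a, (if i < k₀ then Λ / η else 1) * η := by
    refine Finset.prod_le_prod (fun i _ => h0 i) fun i _ => ?_
    split_ifs with h
    · rw [div_mul_cancel₀ _ hη.ne']; exact hΛ i
    · rw [one_mul]; exact hk i (not_lt.1 h)
  refine h1.trans ?_
  rw [Finset.prod_mul_distrib, Finset.prod_const, Finset.card_range]
  refine mul_le_mul_of_nonneg_right ?_ (by positivity)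
  rw [← Finset.prod_filter, Finset.prod_const]
  refine pow_le_pow_right₀ ((one_le_div hη).2 hηΛ) ?_
  have : (Finset.range a).filter (fun i => i < k₀) ⊆ Finset.range k₀ := fun i hi =>
    Finset.mem_range.2 (Finset.mem_filter.1 hi).2
  simpa using Finset.card_le_card this

/-- Exponential decay of the largest eigenvalues. -/
theorem eventually_prod_le_exp {μ : ℕ → ℝ} (h0 : ∀ i, 0 ≤ μ i) (hanti : Antitone μ)
    (h1 : 0 < μ 1) (hlim : Tendsto μ atTop (𝓝 0)) (a : ℕ → ℕ) (ha : ∀ d, a d ≤ d) {C K q : ℝ}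
    (hq : 0 ≤ q)
    (hbound : ∀ d, 1 ≤ d → (∏ i ∈ Finset.range (a d), μ i) * (μ 0 + μ 1) ^ (d - a d)
      ≤ C * (d : ℝ) ^ q * (μ 0 ^ (d - a d) * ∏ i ∈ Finset.range (a d), μ i + K)) :
    ∃ M θ : ℝ, 0 < θ ∧ ∀ᶠ d : ℕ in atTop,
      μ 0 ^ (d - a d) * ∏ i ∈ Finset.range (a d), μ i ≤ M * (d : ℝ) ^ q * Real.exp (-θ * d) := by
  have hμ0 : 0 < μ 0 := h1.trans_le (hanti zero_le_one)
  set Λ := max (μ 0) 1 with hΛ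
  have hΛ1 : 1 ≤ Λ := le_max_right _ _
  -- Chosen so that `d ≤ 2 * a d` gives `η ^ a d ≤ (2 * Λ) ^ (-d)`, which absorbs `Λ ^ d` and leaves
  -- `2 ^ (-d)`.
  set η : ℝ := ((2 * Λ) ^ 2)⁻¹ with hη
  have hη0 : 0 < η := by positivity
  have hηΛ : η ≤ Λ := by
    refine le_trans ?_ hΛ1
    rw [hη]
    exact inv_le_one_of_one_le₀ (by nlinarith)
  obtain ⟨k₀, hk₀⟩ := eventually_atTop.1 (hlim.eventually_le_const hη0)
  set M₁ := (Λ / η) ^ k₀ with hM₁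
  have hM₁0 : 0 ≤ M₁ := by positivity
  -- The half makes `(1 + μ 1 / μ 0) ^ b ≥ exp (c * d)` as soon as `b ≥ d / 2`.
  set c := Real.log (1 + μ 1 / μ 0) / 2 with hc
  have hr : 0 < μ 1 / μ 0 := by positivity
  have hc0 : 0 < c := by
    have := Real.log_pos (show 1 < 1 + μ 1 / μ 0 by linarith)
    positivity
  have hlog2 : 0 < Real.log 2 := Real.log_pos one_lt_two
  refine ⟨max M₁ (2 * C * K), min (Real.log 2) c, lt_min hlog2 hc0, ?_⟩
  have hsmall := ((tendsto_natCast_rpow_mul_exp_neg q c hc0).const_mul C).eventually_le_const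
    (show C * 0 < 1 / 2 by norm_num)
  filter_upwards [hsmall, eventually_ge_atTop 1] with d hd hd1
  have hd1' : (1 : ℝ) ≤ d := by exact_mod_cast hd1
  have hdq : 1 ≤ (d : ℝ) ^ q := Real.one_le_rpow hd1' hq
  set b := d - a d with hb
  have hab : a d + b = d := by have := ha d; omega
  set Q := μ 0 ^ b * ∏ i ∈ Finset.range (a d), μ i with hQ
  have hprod0 : 0 ≤ ∏ i ∈ Finset.range (a d), μ i := Finset.prod_nonneg fun i _ => h0 i
  have hQ0 : 0 ≤ Q := by positivity
  rcases le_total d (2 * a d) with hcase | hcase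
  · have h2 := prod_range_le_const_mul_pow h0 hη0 hηΛ
      (fun i => (hanti (Nat.zero_le i)).trans (le_max_left _ _)) k₀ hk₀ (a d)
    have h3 : Q ≤ M₁ * Real.exp (-Real.log 2 * d) := by
      have e : Real.exp (-Real.log 2 * d) = ((2 : ℝ) ^ d)⁻¹ := by
        rw [neg_mul, Real.exp_neg, mul_comm, Real.exp_nat_mul, Real.exp_log two_pos]
      rw [e]
      have h4 : η ^ a d ≤ ((2 * Λ) ^ d)⁻¹ := by
        rw [hη, inv_pow, ← pow_mul]
        exact inv_anti₀ (by positivity) (pow_le_pow_right₀ (by linarith) hcase)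
      have h5 : μ 0 ^ b ≤ Λ ^ d :=
        (pow_le_pow_left₀ hμ0.le (le_max_left _ _) b).trans
          (pow_le_pow_right₀ hΛ1 (by omega))
      calc Q ≤ Λ ^ d * (M₁ * ((2 * Λ) ^ d)⁻¹) := by
            refine mul_le_mul h5 (h2.trans ?_) hprod0 (by positivity)
            exact mul_le_mul_of_nonneg_left h4 hM₁0
        _ = M₁ * ((2 : ℝ) ^ d)⁻¹ := by
            rw [mul_pow]; field_simp
    refine h3.trans ?_
    refine mul_le_mul ?_ ?_ (Real.exp_nonneg _) (by positivity)
    · exact (le_max_left _ _).trans (le_mul_of_one_le_right (hM₁0.trans (le_max_left _ _)) hdq)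
    · refine Real.exp_le_exp.2 ?_
      have := min_le_left (Real.log 2) c
      nlinarith
  · have h2 := hbound d hd1
    have h3 : Real.exp (c * d) ≤ (1 + μ 1 / μ 0) ^ b := by
      have e : (1 + μ 1 / μ 0) ^ b = Real.exp (c * (2 * b)) := by
        rw [hc, ← Real.exp_log (show 0 < 1 + μ 1 / μ 0 by linarith), ← Real.exp_nat_mul,
          Real.log_exp]
        congr 1
        ring
      rw [e]
      refine Real.exp_le_exp.2 (mul_le_mul_of_nonneg_left ?_ hc0.le)
      have : d ≤ 2 * b := by omega
      exact_mod_cast this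
    have h4 : Q * Real.exp (c * d) ≤ C * (d : ℝ) ^ q * (Q + K) := by
      refine (mul_le_mul_of_nonneg_left h3 hQ0).trans (le_trans (le_of_eq ?_) h2)
      have : μ 0 + μ 1 = μ 0 * (1 + μ 1 / μ 0) := by field_simp
      rw [this, mul_pow, hQ]
      ring
    have he : 0 < Real.exp (c * d) := Real.exp_pos _
    have h5 : C * (d : ℝ) ^ q ≤ 1 / 2 * Real.exp (c * d) := by
      have := mul_le_mul_of_nonneg_right hd he.le
      rwa [neg_mul, Real.exp_neg, mul_assoc, mul_assoc, inv_mul_cancel₀ he.ne', mul_one] at this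
    -- For large `d` the term `C * d ^ q * Q` is at most half of the left side of `h4` and is
    -- absorbed there.
    have h6 : Q * Real.exp (c * d) ≤ 2 * C * K * (d : ℝ) ^ q := by
      nlinarith [mul_le_mul_of_nonneg_right h5 hQ0]
    have h7 : Q ≤ 2 * C * K * (d : ℝ) ^ q * Real.exp (-c * d) := by
      rw [neg_mul, Real.exp_neg, ← div_eq_mul_inv, le_div_iff₀ he]
      exact h6
    refine h7.trans ?_
    refine mul_le_mul ?_ ?_ (Real.exp_nonneg _) (by positivity)
    · exact mul_le_mul_of_nonneg_right (le_max_right _ _) (by positivity)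
    · refine Real.exp_le_exp.2 ?_
      have := min_le_right (Real.log 2) c
      nlinarith

/-! ### Eigenvalues of the antisymmetric problems -/

section Eigenvalues

variable {H G : Type*} [NormedAddCommGroup H] [InnerProductSpace ℝ H] [CompleteSpace H]
  [NormedAddCommGroup G] [InnerProductSpace ℝ G] [CompleteSpace G] {d : ℕ}

theorem inner_map_eigenvector {ι : Type*} [DecidableEq ι] {S : H →L[ℝ] G} {e : ι → H}
    (he : Orthonormal ℝ e) {c : ι → ℝ} (hW : ∀ i, (S.adjoint ∘L S) (e i) = c i • e i) (i j : ι) :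
    inner ℝ (S (e i)) (S (e j)) = if i = j then c i else 0 := by
  have h := hW i
  rw [ContinuousLinearMap.comp_apply] at h
  rw [← ContinuousLinearMap.adjoint_inner_left, h, real_inner_smul_left,
    orthonormal_iff_ite.1 he]
  simp

theorem map_eq_zero_of_adjoint_comp_self {S : H →L[ℝ] G} {x : H} (h : (S.adjoint ∘L S) x = 0) :
    S x = 0 := by
  rw [ContinuousLinearMap.comp_apply] at h
  rw [← inner_self_eq_zero (𝕜 := ℝ), ← ContinuousLinearMap.adjoint_inner_left, h, inner_zero_left]

theorem antisymInitialError_le {S : H →L[ℝ] G} {lam : ℕ → ℝ}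
    (hlam : IsEigenvalueSequence (S.adjoint ∘L S) lam) (I : Finset (Fin d)) :
    antisymInitialError S I ≤
      ENNReal.ofReal √(lam 0 ^ (d - I.card) * ∏ i ∈ Finset.range I.card, lam i) := by
  obtain ⟨hanti, h0, e, he, hW, hker⟩ := hlam
  have hP : 0 ≤ lam 0 ^ (d - I.card) * ∏ i ∈ Finset.range I.card, lam i :=
    mul_nonneg (pow_nonneg (h0 0) _) (Finset.prod_nonneg fun i _ => h0 i)
  refine minimalError_zero_le _ _ hP ?_
  rintro ⟨_, g, rfl⟩
  refine norm_tensorPowerOp_sq_le he S (fun x hx => map_eq_zero_of_adjoint_comp_self (hker x hx))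
    (fun i => lam i) (inner_map_eigenvector he hW) _ hP _ fun k => ?_
  by_cases hk : Set.InjOn (fun l => (k l : ℕ)) I
  · right
    simpa using prod_comp_le_of_injOn hanti h0 I (fun l => (k l : ℕ)) hk
  · left
    simp only [Set.InjOn, not_forall] at hk
    obtain ⟨i, hi, j, hj, hk, hij⟩ := hk
    exact inner_simpleTensor_antisymmetrizer_eq_zero hi hj hij _
      (by simp [Subtype.ext hk]) g

/-- The condition `hT` says that `T` meets each orbit at most once and that stabilizers are trivial.
The antisymmetrized tensors are then nonzero and orthogonal, with common squared length `1 / #𝒮_I`.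
-/
theorem card_le_infoComplexity_antisymProblem {ι : Type*} [DecidableEq ι] {S : H →L[ℝ] G}
    {e : ι → H} (he : Orthonormal ℝ e) {c : ι → ℝ}
    (hW : ∀ i, (S.adjoint ∘L S) (e i) = c i • e i) (I : Finset (Fin d)) (T : Finset (Fin d → ι))
    (hT : ∀ k ∈ T, ∀ k' ∈ T, ∀ π ∈ permsOf I, k ∘ π = k' → π = 1) {ε : ℝ} (hε : 0 ≤ ε)
    (hw : ∀ k ∈ T, ε ^ 2 < ∏ l, c (k l)) :
    (T.card : ℕ∞) ≤ infoComplexity (antisymProblem S I) ε := by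
  rw [← Fintype.card_coe]
  refine card_le_infoComplexity (antisymProblem S I) ε hε
    (fun k : T => ⟨antisymmetrizer H I (simpleTensor (e ∘ k)), simpleTensor (e ∘ k), rfl⟩)
    ((permsOf I).card : ℝ)⁻¹ (inv_pos.2 (card_permsOf_pos I)) (fun k => ∏ l, c (k.1 l)) ?_ ?_
    fun k => hw k k.2
  · intro k k'
    have := inner_antisymmetrizer_of_orthogonal e (fun _ => 1) (orthonormal_iff_ite.1 he) I k k'
      (hT k k.2 k' k'.2)
    rw [Submodule.coe_inner, this]
    simp only [Subtype.coe_inj, Finset.prod_const_one, mul_one]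
  · intro k k'
    have := inner_antisymmetrizer_of_orthogonal (fun i => S (e i)) c (inner_map_eigenvector he hW)
      I k k' (hT k k.2 k' k'.2)
    have e1 : ∀ k : T, antisymProblem S I
        ⟨antisymmetrizer H I (simpleTensor (e ∘ k)), simpleTensor (e ∘ k), rfl⟩
        = antisymmetrizer G I (simpleTensor ((fun i => S (e i)) ∘ (k : Fin d → ι))) := fun k =>
      tensorPowerOp_antisymmetrizer_simpleTensor S I _
    rw [e1, e1, this]
    simp only [Subtype.coe_inj]

theorem injOn_of_comp_perm {ι : Type*} {I : Finset (Fin d)} {k : Fin d → ι}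
    (hk : ∀ π ∈ permsOf I, k ∘ π = k → π = 1) : Set.InjOn k I := by
  intro i hi j hj hij
  have h := hk _ (swap_mem_permsOf hi hj) (by
    funext l
    simp only [Function.comp_apply, Equiv.swap_apply_def]
    split_ifs with h1 h2
    · rw [h1, hij]
    · rw [h2, hij]
    · rfl)
  exact Equiv.swap_eq_one_iff.1 h

/-- The sums of the powers of the eigenvalues of the antisymmetric problems grow polynomially. -/
theorem AntisymPolyTractable.sum_prod_rpow_le {S : H →L[ℝ] G} {lam : ℕ → ℝ}
    (hanti : Antitone lam) (h0 : ∀ i, 0 ≤ lam i) {e : {i : ℕ // 0 < lam i} → H}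
    (he : Orthonormal ℝ e) (hW : ∀ i, (S.adjoint ∘L S) (e i) = lam i • e i)
    {I : (d : ℕ) → Finset (Fin d)} {C p q : ℝ} (hC : 0 < C) (hp : 0 < p)
    (htract : AntisymPolyTractable S I C p q) {τ : ℝ} (hτ : p / 2 < τ) (hd : 1 ≤ d)
    (T : Finset (Fin d → {i : ℕ // 0 < lam i}))
    (hT : ∀ k ∈ T, ∀ k' ∈ T, ∀ π ∈ permsOf (I d), k ∘ π = k' → π = 1) :
    ∑ k ∈ T, ∏ l, lam (k l) ^ τ ≤ C * (d : ℝ) ^ q *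
      ((lam 0 ^ (d - (I d).card) * ∏ i ∈ Finset.range (I d).card, lam i) ^ τ
        + (1 / 2 : ℝ) ^ (-(p / 2)) * (1 - (1 / 2 : ℝ) ^ (τ - p / 2))⁻¹) := by
  have hprod : ∀ k : Fin d → {i : ℕ // 0 < lam i}, ∏ l, lam (k l) ^ τ = (∏ l, lam (k l)) ^ τ :=
    fun k => Real.finsetProd_rpow _ _ (fun l _ => h0 _) τ
  simp_rw [hprod]
  refine sum_rpow_le_of_card_le T (fun k => ∏ l, lam (k l))
    (fun k => Finset.prod_nonneg fun l _ => h0 _) (by positivity) (by positivity) hτ ?_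
    (mul_nonneg (pow_nonneg (h0 0) _) (Finset.prod_nonneg fun i _ => h0 i)) ?_
  · intro t ht ht1
    set T' := T.filter fun k => t < ∏ l, lam (k l) with hT'
    have h1 := card_le_infoComplexity_antisymProblem he hW (I d) T'
      (fun k hk k' hk' => hT k (Finset.mem_filter.1 hk).1 k' (Finset.mem_filter.1 hk').1)
      (Real.sqrt_nonneg t) (fun k hk => by
        rw [Real.sq_sqrt ht.le]
        exact (Finset.mem_filter.1 hk).2)
    -- Eigenvalues are squared errors, so level `t` corresponds to `ε = √t`; this turns the exponent
    -- `p` into `p / 2`.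
    have h2 := htract d hd √t (Real.sqrt_pos.2 ht) (Real.sqrt_le_one.2 ht1)
    have h3 : ((T'.card : ℕ) : ℝ≥0∞) ≤ ENNReal.ofReal (C * √t ^ (-p) * (d : ℝ) ^ q) := by
      refine le_trans ?_ h2
      have := ENat.toENNReal_le.2 h1
      simpa using this
    rw [← ENNReal.ofReal_natCast, ENNReal.ofReal_le_ofReal_iff (by positivity)] at h3
    refine h3.trans_eq ?_
    rw [Real.sqrt_eq_rpow, ← Real.rpow_mul ht.le, show 1 / 2 * -p = -(p / 2) by ring]
    ring
  · intro k hk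
    have hinj : Set.InjOn (fun l => (k l : ℕ)) (I d) := fun i hi j hj hij =>
      injOn_of_comp_perm (hT k hk k hk) hi hj (Subtype.ext hij)
    simpa using prod_comp_le_of_injOn hanti h0 (I d) (fun l => (k l : ℕ)) hinj

theorem sum_subtype_rpow {lam : ℕ → ℝ} (h0 : ∀ i, 0 ≤ lam i) {τ : ℝ} (hτ : 0 < τ) (m : ℕ) :
    ∑ j ∈ (Finset.range m).subtype (fun i => 0 < lam i), lam j ^ τ
      = ∑ j ∈ Finset.range m, lam j ^ τ := by
  rw [Finset.sum_subtype_eq_sum_filter (f := fun j => lam j ^ τ)]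
  refine Finset.sum_filter_of_ne fun j _ hj => ?_
  refine (h0 j).lt_of_ne fun h => hj ?_
  rw [← h, Real.zero_rpow hτ.ne']

/-- Multi-indices that agree on `I` with the increasing enumeration of `I`. -/
theorem exists_multiIndices {lam : ℕ → ℝ} (h0 : ∀ i, 0 ≤ lam i) {τ : ℝ} (hτ : 0 < τ)
    (I : Finset (Fin d)) (hpos : ∀ i < I.card, 0 < lam i) (m : ℕ) :
    ∃ T : Finset (Fin d → {i : ℕ // 0 < lam i}),
      (∀ k ∈ T, ∀ k' ∈ T, ∀ π ∈ permsOf I, k ∘ π = k' → π = 1) ∧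
      ∑ k ∈ T, ∏ l, lam (k l) ^ τ
        = (∏ i ∈ Finset.range I.card, lam i ^ τ)
          * (∑ j ∈ Finset.range m, lam j ^ τ) ^ (d - I.card) := by
  set r : I → {i : ℕ // 0 < lam i} := fun l =>
    ⟨((I.orderIsoOfFin rfl).symm l : Fin I.card), hpos _ (Fin.is_lt _)⟩ with hr
  have hrinj : Function.Injective r := fun l l' h => by
    have h1 : ((I.orderIsoOfFin rfl).symm l : Fin I.card) = (I.orderIsoOfFin rfl).symm l' :=
      Fin.ext (congrArg Subtype.val h)
    exact (I.orderIsoOfFin rfl).symm.injective h1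
  set J := (Finset.range m).subtype (fun i => 0 < lam i) with hJ
  -- On `I` the indices are frozen to distinct values, so only the identity of `𝒮_I` can relate two
  -- members; being a box, the set has a power sum that factors.
  set t : Fin d → Finset {i : ℕ // 0 < lam i} :=
    fun l => if h : l ∈ I then {r ⟨l, h⟩} else J with ht
  have hmem : ∀ k ∈ Fintype.piFinset t, ∀ l (hl : l ∈ I), k l = r ⟨l, hl⟩ := by
    intro k hk l hl
    have := Fintype.mem_piFinset.1 hk l
    simpa [ht, hl] using this
  refine ⟨Fintype.piFinset t, ?_, ?_⟩
  · intro k hk k' hk' π hπ h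
    ext l
    by_cases hl : l ∈ I
    · have hπl : π l ∈ I := by
        by_contra hn
        have h1 := mem_permsOf.1 hπ _ hn
        exact hn (by rwa [π.injective h1])
      have h1 := congrFun h l
      rw [Function.comp_apply, hmem k hk _ hπl, hmem k' hk' _ hl] at h1
      have := congrArg Subtype.val (hrinj h1)
      simp only at this
      rw [this]
      rfl
    · rw [mem_permsOf.1 hπ l hl]
      rfl
  · rw [← Finset.prod_univ_sum t fun _ j => lam j ^ τ, ← Finset.prod_mul_prod_compl I]
    congr 1
    · rw [← Finset.prod_coe_sort, Finset.prod_range,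
        ← Equiv.prod_comp (I.orderIsoOfFin rfl).symm.toEquiv]
      refine Finset.prod_congr rfl fun l _ => ?_
      simp [ht, hr]
    · rw [← sum_subtype_rpow h0 hτ, ← hJ,
        Finset.prod_congr rfl (g := fun _ => ∑ j ∈ J, lam j ^ τ) fun l hl => by
          simp [ht, Finset.mem_compl.1 hl],
        Finset.prod_const, Finset.card_compl, Fintype.card_fin]

end Eigenvalues

/-! ### Asymptotics in the dimension -/

theorem tendsto_pow_mul_ofReal_sqrt {e : ℕ → ℝ≥0∞} {x : ℕ → ℝ} (k : ℕ)
    (he : ∀ d, e d ≤ ENNReal.ofReal √(x d))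
    (hx : Tendsto (fun d : ℕ => (d : ℝ) ^ k * √(x d)) atTop (𝓝 0)) :
    Tendsto (fun d : ℕ => (d : ℝ≥0∞) ^ k * e d) atTop (𝓝 0) := by
  have h1 := ENNReal.tendsto_ofReal hx
  rw [ENNReal.ofReal_zero] at h1
  refine tendsto_of_tendsto_of_tendsto_of_le_of_le tendsto_const_nhds h1 (fun _ => zero_le)
    fun d => ?_
  rw [ENNReal.ofReal_mul (by positivity), ENNReal.ofReal_pow (Nat.cast_nonneg d),
    ENNReal.ofReal_natCast]
  gcongr
  exact he d

/-- If the products `P d` are eventually at most one, polynomial bounds for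
`(∏ i < a d, μ i) * N ^ (d - a d)` bound the averages of `log (N / μ i)` from below. -/
theorem exists_log_sub_le_average {μ : ℕ → ℝ} {N : ℝ} (hN : 0 < N) (a : ℕ → ℕ)
    (ha : ∀ d, a d ≤ d) (hpos : ∀ d, 1 ≤ d → ∀ i < a d, 0 < μ i) {B q : ℝ} (hB : 0 < B)
    (h : ∀ᶠ d : ℕ in atTop, (∏ i ∈ Finset.range (a d), μ i) * N ^ (d - a d) ≤ B * (d : ℝ) ^ q)
    {δ : ℝ} (hδ : 0 < δ) : ∃ d₀ : ℕ, ∀ d : ℕ, d₀ ≤ d →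
      Real.log N - δ ≤ 1 / (d : ℝ) * ∑ k ∈ Finset.range (a d), Real.log (N / μ k) := by
  have hlim : Tendsto (fun d : ℕ => (Real.log B + q * Real.log d) / d) atTop (𝓝 0) := by
    have h1 : Tendsto (fun d : ℕ => Real.log B / (d : ℝ)) atTop (𝓝 0) :=
      tendsto_const_nhds.div_atTop tendsto_natCast_atTop_atTop
    have h2 : Tendsto (fun d : ℕ => Real.log d / (d : ℝ)) atTop (𝓝 0) :=
      (Real.isLittleO_log_id_atTop.tendsto_div_nhds_zero).comp tendsto_natCast_atTop_atTop
    have h3 := h1.add (h2.const_mul q)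
    rw [mul_zero, add_zero] at h3
    refine h3.congr fun d => ?_
    ring
  refine eventually_atTop.1 ?_
  filter_upwards [h, hlim.eventually_le_const hδ, eventually_ge_atTop 1] with d hd hdδ hd1
  have hd0 : (0 : ℝ) < d := Nat.cast_pos.2 hd1
  have hμ : ∀ i ∈ Finset.range (a d), 0 < μ i := fun i hi => hpos d hd1 i (Finset.mem_range.1 hi)
  -- In logarithms the bound reads `d * log N - ∑ log (N / μ k) ≤ log B + q * log d`, whose right
  -- side is eventually at most `δ * d`.
  have hlog := Real.log_le_log (mul_pos (Finset.prod_pos hμ) (pow_pos hN _)) hd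
  rw [Real.log_mul (Finset.prod_pos hμ).ne' (pow_pos hN _).ne',
    Real.log_prod fun i hi => (hμ i hi).ne', Real.log_pow,
    Real.log_mul hB.ne' (Real.rpow_pos_of_pos hd0 _).ne', Real.log_rpow hd0,
    Nat.cast_sub (ha d)] at hlog
  have hsum : ∑ k ∈ Finset.range (a d), Real.log (N / μ k)
      = a d * Real.log N - ∑ k ∈ Finset.range (a d), Real.log (μ k) := by
    rw [Finset.sum_congr rfl fun k hk => Real.log_div hN.ne' (hμ k hk).ne',
      Finset.sum_sub_distrib, Finset.sum_const, Finset.card_range, nsmul_eq_mul]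
  rw [div_le_iff₀ hd0] at hdδ
  rw [hsum, one_div, inv_mul_eq_div, le_div_iff₀ hd0]
  linarith

theorem mainTheorem6
    {H G : Type*}
    [NormedAddCommGroup H] [InnerProductSpace ℝ H] [CompleteSpace H]
    [NormedAddCommGroup G] [InnerProductSpace ℝ G] [CompleteSpace G]
    (S : H →L[ℝ] G) (hS : IsCompactOperator S)
    (lam : ℕ → ℝ) (hlam : IsEigenvalueSequence (S.adjoint ∘L S) lam)
    (hlam2 : 0 < lam 1)
    (I : (d : ℕ) → Finset (Fin d)) (hI : ∀ d, 1 ≤ d → (I d).Nonempty)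
    (hinit : ∀ d, 1 ≤ d → 0 < antisymInitialError S (I d))
    (C p q : ℝ) (hC : 0 < C) (hp : 0 < p) (hq : 0 ≤ q)
    (htract : AntisymPolyTractable S I C p q) :
    (∀ k : ℕ, Tendsto (fun d : ℕ => (d : ℝ≥0∞) ^ k * antisymInitialError S (I d))
      atTop (𝓝 0)) ∧
    (∀ τ : ℝ, p / 2 < τ →
      Summable (fun m => lam m ^ τ) ∧
      ∀ δ : ℝ, 0 < δ → ∃ d₀ : ℕ, ∀ d : ℕ, d₀ ≤ d →
        Real.log (∑' m, lam m ^ τ) - δ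
          ≤ 1 / (d : ℝ) * ∑ k ∈ Finset.range (I d).card,
              Real.log ((∑' m, lam m ^ τ) / lam k ^ τ)) ∧
    (lam 0 < 1 ∨ Tendsto (fun d : ℕ => (I d).card) atTop atTop) := by
  obtain ⟨hanti, h0, e, he, hW, -⟩ := id hlam
  set a : ℕ → ℕ := fun d => (I d).card with ha
  have had : ∀ d, a d ≤ d := fun d => by simpa using Finset.card_le_univ (I d)
  set P : ℕ → ℝ := fun d => lam 0 ^ (d - a d) * ∏ i ∈ Finset.range (a d), lam i with hP
  have hP0 : ∀ d, 0 ≤ P d := fun d =>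
    mul_nonneg (pow_nonneg (h0 0) _) (Finset.prod_nonneg fun i _ => h0 i)
  have hup : ∀ d, antisymInitialError S (I d) ≤ ENNReal.ofReal √(P d) := fun d =>
    antisymInitialError_le hlam (I d)
  -- A positive initial error forces `P d > 0`, hence all its factors are nonzero.
  have hpos : ∀ d, 1 ≤ d → ∀ i < a d, 0 < lam i := by
    intro d hd i hi
    have h1 := (hinit d hd).trans_le (hup d)
    rw [ENNReal.ofReal_pos, Real.sqrt_pos] at h1
    have h2 := (mul_ne_zero_iff.1 h1.ne').2
    exact (h0 i).lt_of_ne' (Finset.prod_ne_zero_iff.1 h2 i (Finset.mem_range.2 hi))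
  have hsumm : ∀ τ : ℝ, p / 2 < τ → Summable fun m => lam m ^ τ := by
    intro τ hτ
    refine summable_of_sum_range_le (c := C * ((1 : ℕ) : ℝ) ^ q * (P 1 ^ τ +
      (1 / 2 : ℝ) ^ (-(p / 2)) * (1 - (1 / 2 : ℝ) ^ (τ - p / 2))⁻¹))
      (fun m => Real.rpow_nonneg (h0 m) τ) fun m => ?_
    -- In dimension one the only permutation is the identity, so every finite set of indices is
    -- admissible.
    have h1 := htract.sum_prod_rpow_le hanti h0 he hW hC hp hτ le_rfl
      (Fintype.piFinset fun _ => (Finset.range m).subtype (fun i => 0 < lam i))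
      (fun _ _ _ _ _ _ _ => Subsingleton.elim _ _)
    rw [← Finset.prod_univ_sum (fun _ => (Finset.range m).subtype (fun i => 0 < lam i))
      fun _ j => lam j ^ τ, Fin.prod_univ_one, sum_subtype_rpow h0 (by linarith)] at h1
    exact h1
  have hbound : ∀ τ : ℝ, p / 2 < τ → ∃ K : ℝ, ∀ d, 1 ≤ d → ∀ m,
      (∏ i ∈ Finset.range (a d), lam i ^ τ)
        * (∑ j ∈ Finset.range m, lam j ^ τ) ^ (d - a d) ≤ C * (d : ℝ) ^ q * (P d ^ τ + K) := by
    intro τ hτ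
    refine ⟨(1 / 2 : ℝ) ^ (-(p / 2)) * (1 - (1 / 2 : ℝ) ^ (τ - p / 2))⁻¹, fun d hd m => ?_⟩
    obtain ⟨T, hT, hTsum⟩ :=
      exists_multiIndices h0 (show 0 < τ by linarith) (I d) (hpos d hd) m
    rw [← hTsum]
    exact htract.sum_prod_rpow_le hanti h0 he hW hC hp hτ hd T hT
  have hPk : ∀ k : ℕ, Tendsto (fun d : ℕ => (d : ℝ) ^ k * √(P d)) atTop (𝓝 0) := by
    have hPp : ∀ d, P d ^ p
        = (lam 0 ^ p) ^ (d - a d) * ∏ i ∈ Finset.range (a d), lam i ^ p := by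
      intro d
      rw [hP, Real.mul_rpow (pow_nonneg (h0 0) _) (Finset.prod_nonneg fun i _ => h0 i),
        Real.rpow_pow_comm (h0 0), Real.finsetProd_rpow _ _ fun i _ => h0 i]
    -- Any exponent above `p / 2` would serve; `p` is a convenient one. Below, `m = 2` keeps just
    -- the two largest eigenvalues.
    obtain ⟨K, hK⟩ := hbound p (by linarith)
    obtain ⟨M, θ, hθ, h⟩ := eventually_prod_le_exp (fun i => Real.rpow_nonneg (h0 i) p)
      (fun i j hij => Real.rpow_le_rpow (h0 j) (hanti hij) hp.le) (Real.rpow_pos_of_pos hlam2 p)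
      (hsumm p (by linarith)).tendsto_atTop_zero a had hq (C := C) (K := K) (fun d hd => by
        have := hK d hd 2
        rwa [Finset.sum_range_succ, Finset.sum_range_one, hPp] at this)
    refine tendsto_pow_mul_sqrt_of_rpow_le hP0 hp hθ (M := M) (q := q) ?_
    filter_upwards [h] with d hd
    rwa [hPp]
  have hPlim : Tendsto (fun d => √(P d)) atTop (𝓝 0) := by simpa using hPk 0
  refine ⟨fun k => tendsto_pow_mul_ofReal_sqrt k hup (hPk k), fun τ hτ => ⟨hsumm τ hτ, ?_⟩, ?_⟩
  · have hτ0 : 0 < τ := by linarith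
    have hN : 0 < ∑' m, lam m ^ τ := (hsumm τ hτ).tsum_pos (fun m => Real.rpow_nonneg (h0 m) τ) 1
      (Real.rpow_pos_of_pos hlam2 τ)
    obtain ⟨K, hK⟩ := hbound τ hτ
    intro δ hδ
    refine exists_log_sub_le_average hN a had
      (fun d hd i hi => Real.rpow_pos_of_pos (hpos d hd i hi) τ)
      (show 0 < C * (1 + |K|) by positivity) (q := q) ?_ hδ
    filter_upwards [hPlim.eventually_le_const one_pos, eventually_ge_atTop 1] with d hd hd1
    -- The constant `K` does not depend on `m`, so the partial sums may be replaced by the full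
    -- series.
    have h1 := ((hsumm τ hτ).tendsto_sum_tsum_nat.pow (d - a d)).const_mul
      (∏ i ∈ Finset.range (a d), lam i ^ τ)
    refine (le_of_tendsto' h1 (hK d hd1)).trans ?_
    have h2 : P d ^ τ ≤ 1 := Real.rpow_le_one (hP0 d) (Real.sqrt_le_one.1 hd) hτ0.le
    calc C * (d : ℝ) ^ q * (P d ^ τ + K) ≤ C * (d : ℝ) ^ q * (1 + |K|) := by
          gcongr
          exact le_abs_self K
      _ = _ := by ring
  · by_contra! hcon
    obtain ⟨hl, hnot⟩ := hcon
    rw [tendsto_atTop] at hnot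
    push Not at hnot
    obtain ⟨A, hA⟩ := hnot
    -- A positive lower bound for `∏ i < a d, lam i` over all `d ≥ 1` with `a d < A`: capping at `1`
    -- makes extra factors harmless, and vanishing eigenvalues never occur below `a d`.
    set c := Finset.prod (Finset.range A) fun i => if 0 < lam i then min (lam i) 1 else 1 with hc
    have hc0 : 0 < c := Finset.prod_pos fun i _ => by
      split_ifs with h
      · exact lt_min h one_pos
      · exact one_pos
    have hsmall := hPlim.eventually_lt_const (Real.sqrt_pos.2 hc0)
    obtain ⟨d, hdA, hd, hd1⟩ := (hA.and_eventually (hsmall.and (eventually_ge_atTop 1))).exists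
    refine absurd hd (not_lt.2 (Real.sqrt_le_sqrt ?_))
    have h1 : c ≤ ∏ i ∈ Finset.range (a d), lam i := by
      have hsub : Finset.range (a d) ⊆ Finset.range A := Finset.range_subset_range.2 hdA.le
      refine (Finset.prod_le_prod_of_subset_of_le_one hsub (fun i _ => ?_) fun i _ _ => ?_).trans
        (Finset.prod_le_prod (fun i _ => ?_) fun i hi => ?_)
      · split_ifs with h
        · exact (lt_min h one_pos).le
        · exact zero_le_one
      · split_ifs
        · exact min_le_right _ _
        · exact le_rfl
      · split_ifs with h
        · exact (lt_min h one_pos).le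
        · exact zero_le_one
      · rw [if_pos (hpos d hd1 i (Finset.mem_range.1 hi))]
        exact min_le_left _ _
    exact h1.trans (le_mul_of_one_le_left (Finset.prod_nonneg fun i _ => h0 i) (one_le_pow₀ hl))
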